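/- Let $S^1=\mathbb R/\mathbb Z$. For $a,b\in S^1$ let $[a,b]$ be the closed arc from $a$ to $b$ in the positive direction and $\ell([a,b])\in[0,1)$ its length; $\mathrm{dist}$ is the length of the shorter arc between two points. An orientation-preserving homeomorphism $f$ of $S^1$ has a continuous strictly increasing lift $F:\mathbb R\to\mathbb R$ with $F(x+1)=F(x)+1$ and $f(x)=F(x) \bmod 1$; its rotation number is $\rho_f=\lim F^n(x)/n \bmod 1$, and derivatives are those of the lift. It is a P-homeomorphism if it is differentiable outside a finite set $B(f)$ of break points, at each of which it is not differentiable but has one-sided derivatives $Df_-\ne Df_+$; there are constants $0<c_1<c_2<\infty$ such that $Df$ (off $B(f)$) and $Df_\pm$ (on $B(f)$) take values in $(c_1,c_2)$; and $\log Df$ has bounded variation. Put $\sigma_f(b)=Df_-(b)/Df_+(b)$ for $b\in B(f)$ and $\sigma_f(B)=\prod_{b\in B}\sigma_f(b)$ for $B\subseteq B(f)$, with $\sigma_f(\emptyset)=1$. **Regular coverings.** Let $f$ be a P-homeomorphism, $x_0\in S^1$, let $z_1\prec z_2\prec z_3\prec z_4\prec z_1$ be points of $S^1$ in this cyclic order,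 and let $r\in\mathbb N$, $K>M\ge 1$, $\delta>0$, $\zeta\in(0,1)$. The triple $([z_s,z_{s+1}])_{s=1,2,3}$ covers a non-empty set $\widehat B\subseteq B(f)$ "$(K,M,\delta,\zeta;x_0)$-regularly" for $r$ if the arcs $f^j([z_1,z_4])$, $0\le j\le r-1$, are pairwise disjoint and: 1. every point of $[z_1,z_4]$ has distance less than $\delta$ from $x_0$, and every $b\in\widehat B$ lies in $f^j([z_1,z_4])$ for exactly one $j\in\{0,\dots,r-1\}$; let $\overline b\in[z_1,z_4]$ be the point with $f^{j}(\overline b)=b$ for this $j$; 2. $\overline b\in[z_1,z_2]$ for all $b\in\widehat B$; 3. $M\,\ell([z_1,z_2])\le \ell([z_2,z_3])\le K\,\ell([z_1,z_2])$ and $K^{-1}\ell([z_3,z_4])\le\ell([z_2,z_3])\le K\,\ell([z_3,z_4])$; 4. the lengths $\ell(f^{r}([z_s,z_{s+1}]))$, $s=1,2,3$, are pairwise $K$-comparable, i.e. any two of them, $u$ and $v$, satisfy $K^{-1}v\le u\le Kv$; 5. $\mathrm{dist}(z_i,x_0)\le K\,\ell([z_1,z_2])$ and $\mathrm{dist}(f^{r}(z_i),x_0)\le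 K\,\ell([z_1,z_2])$ for $i=1,2,3,4$; 6. $\ell([\overline b,z_2])/\ell([z_1,z_2])<\zeta$ for all $b\in\widehat B$. Let $f_1,f_2$ be P-homeomorphisms and $h$ a homeomorphism with $h\circ f_1=f_2\circ h$. The triples $([z_s,z_{s+1}])_{s=1,2,3}$ and $([h(z_s),h(z_{s+1})])_{s=1,2,3}$ cover the sets $\widehat B_1\subseteq B(f_1)$ and $\widehat B_2\subseteq B(f_2)$ "$(K,M,\delta,\zeta;x_0,h(x_0))$-regularly" for $r$ if $\widehat B_1$ is the set of all break points of $f_1$ that lie in $\bigcup_{0\le j<r}f_1^j([z_1,z_4])$, $\widehat B_2$ is the set of all break points of $f_2$ that lie in $\bigcup_{0\le j<r}f_2^j([h(z_1),h(z_4)])$, and: if $\widehat B_1\neq\emptyset$, the first triple covers $\widehat B_1$ $(K,M,\delta,\zeta;x_0)$-regularly for $r$ under $f_1$; if $\widehat B_2\ne\emptyset$, the second triple covers $\widehat B_2$ $(K,M,\delta,\zeta;h(x_0))$-regularly for $r$ under $f_2$. **Theorem.** Let $f_1,f_2$ be P-homeomorphisms with the same irrational rotation number $\rho$, let $p_n/q_n$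 be the convergents of the continued fraction of $\rho$, and let $\alpha>0$. Assume that each $f_i$ is $C^{2+\alpha}$ on each interval of continuity of $Df_i$ and that the total jumps differ, $\sigma_{f_1}(B(f_1))\neq\sigma_{f_2}(B(f_2))$. Let $M\ge 1$ and $\zeta\in(0,1)$. Then there is a constant $K=K(f_1,f_2,M,\zeta)>M$ with the following property. Let $h$ be an orientation-preserving homeomorphism of $S^1$ with $h\circ f_1=f_2\circ h$, let $x_0\in S^1$ be a point at which $Dh(x_0)=\omega_0$ exists and $\omega_0>0$, and let $\delta\in(0,1)$. Then for every sufficiently large $n$ there are sets $\widehat B_1\subseteq B(f_1)$ and $\widehat B_2\subseteq B(f_2)$ that are "not jump-coinciding", i.e. $\sigma_{f_1}(\widehat B_1)\ne\sigma_{f_2}(\widehat B_2)$, points $z_1\prec z_2\prec z_3\prec z_4\prec z_1$ of $S^1$, and $r_n\in\{q_{n-1},\,q_n,\,q_n+q_{n-1}\}$ such that the triples $([z_s,z_{s+1}])_{s=1,2,3}$ and $([h(z_s),h(z_{s+1})])_{s=1,2,3}$ cover $\widehat B_1$ and $\widehat B_2$ $(K,M,\delta,\zeta;x_0,h(x_0))$-regularly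 for $r_n$. -/

import Mathlib

open Set Filter Topology
open scoped NNReal

namespace CircleBreak

/-! ### The circle `ℝ / ℤ`: arcs and their lengths -/

/-- Length of the arc that runs from `a` to `b` in the positive direction; it lies in `[0, 1)`. -/
noncomputable def arcLength (a b : UnitAddCircle) : ℝ :=
  (AddCircle.equivIco (1 : ℝ) 0 (b - a) : ℝ)

/-- The closed arc `[a, b]`, from `a` to `b` in the positive direction. -/
def arc (a b : UnitAddCircle) : Set UnitAddCircle :=
  {x | arcLength a x ≤ arcLength a b}

/-- `z₁ ≺ z₂ ≺ z₃ ≺ z₄ ≺ z₁` in the cyclic order of the circle. -/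
def CyclicallyOrdered (z₁ z₂ z₃ z₄ : UnitAddCircle) : Prop :=
  0 < arcLength z₁ z₂ ∧ arcLength z₁ z₂ < arcLength z₁ z₃ ∧ arcLength z₁ z₃ < arcLength z₁ z₄

/-! ### Orientation preserving homeomorphisms and rotation numbers -/

/-- `F` is a lift of the circle homeomorphism `f`: continuous, strictly increasing,
`F (x + 1) = F x + 1` (this is part of `CircleDeg1Lift`) and `f x = F x mod 1`.
A circle homeomorphism is orientation preserving iff it has such a lift. -/
structure IsLift (F : CircleDeg1Lift) (f : UnitAddCircle ≃ₜ UnitAddCircle) : Prop where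
  continuous : Continuous F
  strictMono : StrictMono F
  coe_apply : ∀ x : ℝ, ((F x : ℝ) : UnitAddCircle) = f (x : UnitAddCircle)

/-- The rotation number `lim Fⁿ(x) / n mod 1`, as a number in `[0, 1)`. -/
noncomputable def rotationNumber (F : CircleDeg1Lift) : ℝ :=
  Int.fract F.translationNumber

/-- The denominator `q_n` of the `n`-th convergent of the continued fraction of `ρ`. -/
noncomputable def cfDenom (ρ : ℝ) (n : ℕ) : ℕ :=
  (ρ.convergent n).den

/-! ### Break points and the class P

All notions are read off a lift `F`; they do not depend on which lift is taken. -/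

/-- The set of break points, the points of the circle at which the map is not differentiable. -/
def breakSet (F : ℝ → ℝ) : Set UnitAddCircle :=
  {b | ∃ x : ℝ, (x : UnitAddCircle) = b ∧ ¬ DifferentiableAt ℝ F x}

/-- The jump ratio `Df₋(b) / Df₊(b)`, computed at the representative of `b` in `[0, 1)`. -/
noncomputable def jumpRatio (F : ℝ → ℝ) (b : UnitAddCircle) : ℝ :=
  let x : ℝ := AddCircle.equivIco (1 : ℝ) 0 b
  derivWithin F (Iic x) x / derivWithin F (Ici x) x

/-- The product of the jump ratios over a set of (break) points; it is `1` for the empty set. -/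
noncomputable def jumpProduct (F : ℝ → ℝ) (B : Set UnitAddCircle) : ℝ :=
  ∏ᶠ b ∈ B, jumpRatio F b

/-- The class of P-homeomorphisms. -/
structure IsPHomeo (F : ℝ → ℝ) : Prop where
  finite_breakSet : (breakSet F).Finite
  bounds : ∃ c₁ c₂ : ℝ, 0 < c₁ ∧ c₁ < c₂ ∧
    (∀ x, DifferentiableAt ℝ F x → deriv F x ∈ Ioo c₁ c₂) ∧
    (∀ x, ¬ DifferentiableAt ℝ F x → ∃ dl dr : ℝ,
      HasDerivWithinAt F dl (Iic x) x ∧ HasDerivWithinAt F dr (Ici x) x ∧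
      dl ∈ Ioo c₁ c₂ ∧ dr ∈ Ioo c₁ c₂ ∧ dl ≠ dr)
  boundedVariation_log_deriv :
    BoundedVariationOn (fun x => Real.log (deriv F x))
      {x | x ∈ Icc (0 : ℝ) 1 ∧ DifferentiableAt ℝ F x}

/-- `F` is `C^{2+α}` on each interval of continuity of its derivative: there the second derivative
exists, is continuous, and is Hölder continuous with exponent `α`. -/
def IsPiecewiseC2Holder (α : ℝ≥0) (F : ℝ → ℝ) : Prop :=
  ∀ a b : ℝ, (∀ x ∈ Ioo a b, DifferentiableAt ℝ F x) → ContinuousOn (deriv F) (Ioo a b) →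
    ContDiffOn ℝ 2 F (Ioo a b) ∧ ∃ C : ℝ≥0, HolderOnWith C α (deriv (deriv F)) (Ioo a b)

/-! ### Regular coverings of break points -/

/-- Two lengths are `K`-comparable. -/
def Comparable (K s t : ℝ) : Prop := K⁻¹ * t ≤ s ∧ s ≤ K * t

/-- The points of `B` that are covered by the system of arcs `f^j([z₁, z₄])`, `0 ≤ j ≤ r - 1`. -/
def coveredBy (f : UnitAddCircle → UnitAddCircle) (r : ℕ) (z₁ z₄ : UnitAddCircle)
    (B : Set UnitAddCircle) : Set UnitAddCircle :=
  {b | b ∈ B ∧ ∃ j < r, b ∈ f^[j] '' arc z₁ z₄}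

/-- The triple of arcs `[z₁, z₂], [z₂, z₃], [z₃, z₄]` covers the set `B` of break points
of `f` `(K, M, δ, ζ; x₀)`-regularly, with the iteration number `r`. A point `y ∈ [z₁, z₄]` with
`f^j(y) = b`, `0 ≤ j ≤ r - 1`, is the `r`-preimage of `b`. The distance `dist` of the circle `ℝ / ℤ`
is the length of the shorter arc between two points. -/
structure CoversRegularly (f : UnitAddCircle → UnitAddCircle) (r : ℕ) (B : Set UnitAddCircle)
    (K M δ ζ : ℝ) (x₀ z₁ z₂ z₃ z₄ : UnitAddCircle) : Prop where
  small : ∀ i < r, ∀ j < r, i ≠ j → Disjoint (f^[i] '' arc z₁ z₄) (f^[j] '' arc z₁ z₄)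
  subset_ball : arc z₁ z₄ ⊆ Metric.ball x₀ δ
  covers_once : ∀ b ∈ B, ∃! j : ℕ, j < r ∧ b ∈ f^[j] '' arc z₁ z₄
  preimage_mem : ∀ b ∈ B, ∀ j < r, ∀ y ∈ arc z₁ z₄, f^[j] y = b → y ∈ arc z₁ z₂
  length_left : M * arcLength z₁ z₂ ≤ arcLength z₂ z₃ ∧
    arcLength z₂ z₃ ≤ K * arcLength z₁ z₂
  length_right : Comparable K (arcLength z₂ z₃) (arcLength z₃ z₄)
  image_comparable :
    Comparable K (arcLength (f^[r] z₁) (f^[r] z₂)) (arcLength (f^[r] z₂) (f^[r] z₃)) ∧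
    Comparable K (arcLength (f^[r] z₁) (f^[r] z₂)) (arcLength (f^[r] z₃) (f^[r] z₄)) ∧
    Comparable K (arcLength (f^[r] z₂) (f^[r] z₃)) (arcLength (f^[r] z₃) (f^[r] z₄))
  near : ∀ z ∈ ({z₁, z₂, z₃, z₄} : Set UnitAddCircle),
    dist (f^[r] z) x₀ ≤ K * arcLength z₁ z₂ ∧ dist z x₀ ≤ K * arcLength z₁ z₂
  preimage_near : ∀ b ∈ B, ∀ j < r, ∀ y ∈ arc z₁ z₄, f^[j] y = b →
    arcLength y z₂ / arcLength z₁ z₂ < ζ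

/-- The triples `[z_s, z_{s+1}]` and `[h(z_s), h(z_{s+1})]` cover the sets `B₁`, `B₂` of break points
`(K, M, δ, ζ; x₀, h(x₀))`-regularly with the iteration number `r`. Here `A₁`, `A₂` are the sets of
all break points of `f₁`, `f₂`; the set `B₁` consists of those elements of `A₁` that the arcs
`f₁^j([z₁, z₄])`, `0 ≤ j ≤ r - 1`, cover, and `B₂` of those elements of `A₂` that the arcs
`f₂^j([h(z₁), h(z₄)])`, `0 ≤ j ≤ r - 1`, cover. Each non-empty one is covered regularly. -/
structure CoversPairRegularly (f₁ f₂ h : UnitAddCircle → UnitAddCircle) (r : ℕ)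
    (A₁ A₂ B₁ B₂ : Set UnitAddCircle) (K M δ ζ : ℝ) (x₀ z₁ z₂ z₃ z₄ : UnitAddCircle) :
    Prop where
  covered_fst : coveredBy f₁ r z₁ z₄ A₁ = B₁
  covered_snd : coveredBy f₂ r (h z₁) (h z₄) A₂ = B₂
  regular_fst : B₁.Nonempty → CoversRegularly f₁ r B₁ K M δ ζ x₀ z₁ z₂ z₃ z₄
  regular_snd : B₂.Nonempty →
    CoversRegularly f₂ r B₂ K M δ ζ (h x₀) (h z₁) (h z₂) (h z₃) (h z₄)

end CircleBreak

/-! The conjugacy carries `f₁^j([z₁, z₄])` to `f₂^j([h z₁, h z₄])`, so a break `b` of `f₂` is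
covered exactly when `h⁻¹ b` is covered by the `f₁`-tower. All breaks thus become marked points of
`f₁` alone: a break of `f₁` is weighted by its jump ratio, a break `b` of `f₂` sits at `h⁻¹ b` and
is weighted by the inverse ratio. The total weight is not 1, and what is sought is a regular triple
whose covered marked points also have weight different from 1.

Let `G = F^q - p` and `R = F^Q - P` be the returns at consecutive denominators. For every base `w`,
the images of `[w, G w]` at levels below `Q` and those of `[R w, w]` at levels below `q` tile the
circle (`tower_sum`). Each marked point lies in exactly one of the two towers, so one tower has
weight different from 1. The base is put inside an interval that meets no marked point for `Q + q`
steps (pigeonhole, `exists_free_Ioc`), so in either window the marked points stay away from both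
ends (`ReturnPair.exists_goodWindow`). Inside the window the points are split at large gaps, always
keeping a part of nontrivial weight, until that part is a tight cluster; `z₂` is its rightmost point
(`exists_cluster`).

Lengths are compared by Denjoy distortion: the variation of `log DF`, summed over a tower, is at
most its total `V` over the circle. The same bound excludes wandering intervals (`exists_step_lt`),
so the windows shrink to `x₀`.

The triple is as long as its distance to `x₀`, up to constants, so positivity of `Dh(x₀)` makes `h`
affine on it with small relative error and the proportions survive for `f₂`. The constants depend on
`V`, the number of breaks, `M` and `ζ`, but not on the positions of the marked points, whence `K`
does not depend on `h`, `x₀` or `δ`. -/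

namespace CircleBreak

/-! ### Lifts as real functions, reflection -/

/-- A continuous strictly increasing function that commutes with `x ↦ x + 1`. -/
structure IsLiftFun (F : ℝ → ℝ) : Prop where
  strictMono : StrictMono F
  continuous : Continuous F
  map_add_one : ∀ x, F (x + 1) = F x + 1

/-- Conjugation by `x ↦ -x`. -/
def reflect (F : ℝ → ℝ) (x : ℝ) : ℝ := -F (-x)

theorem reflect_iterate (F : ℝ → ℝ) (n : ℕ) (x : ℝ) :
    (reflect F)^[n] x = -F^[n] (-x) := by
  induction n generalizing x with
  | zero => simp
  | succ n ih => rw [Function.iterate_succ_apply, ih, Function.iterate_succ_apply]; simp [reflect]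

theorem map_add_intCast {μ : ℝ → ℝ} {V : ℝ} (hμ : ∀ x, μ (x + 1) = μ x + V) (x : ℝ) (k : ℤ) :
    μ (x + k) = μ x + k * V := by
  induction k using Int.induction_on with
  | zero => simp
  | succ n ih => push_cast at ih ⊢; rw [← add_assoc, hμ, ih]; ring
  | pred n ih =>
    have := hμ (x + ((-(n : ℤ) - 1 : ℤ) : ℝ))
    push_cast at this ih ⊢
    rw [show x + (-(n : ℝ) - 1) + 1 = x + -(n : ℝ) by ring, ih] at this
    linarith

namespace IsLiftFun

variable {F : ℝ → ℝ}

theorem map_add_int (hF : IsLiftFun F) (x : ℝ) (k : ℤ) : F (x + k) = F x + k := by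
  simpa using map_add_intCast hF.map_add_one x k

theorem iterate (hF : IsLiftFun F) (n : ℕ) : IsLiftFun F^[n] := by
  refine ⟨hF.strictMono.iterate n, hF.continuous.iterate n, ?_⟩
  induction n with
  | zero => simp
  | succ n ih => intro x; rw [Function.iterate_succ_apply', ih, hF.map_add_one,
      Function.iterate_succ_apply']

theorem surjective (hF : IsLiftFun F) : Function.Surjective F := by
  intro y
  have h := map_add_intCast hF.map_add_one 0
  refine mem_range_of_exists_le_of_exists_ge hF.continuous
    ⟨0 + (⌊y - F 0⌋ : ℤ), ?_⟩ ⟨0 + (⌈y - F 0⌉ : ℤ), ?_⟩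
  · rw [h]; linarith [Int.floor_le (y - F 0)]
  · rw [h]; linarith [Int.le_ceil (y - F 0)]

theorem reflect (hF : IsLiftFun F) : IsLiftFun (reflect F) := by
  refine ⟨fun x y h => ?_, (hF.continuous.comp continuous_neg).neg, fun x => ?_⟩
  · have := hF.strictMono (neg_lt_neg h)
    simpa [CircleBreak.reflect] using this
  · have := hF.map_add_one (-(x + 1))
    simp only [CircleBreak.reflect]
    rw [show -(x + 1) + 1 = -x by ring] at this
    linarith

end IsLiftFun

/-! ### Bounded distortion -/

/-- `m` is a monotone function with `m (x + 1) = m x + V` whose increments control the logarithmic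
oscillation of the difference quotients of `F`. -/
structure Distorts (F m : ℝ → ℝ) (V : ℝ) : Prop where
  mono : Monotone m
  add_one : ∀ x, m (x + 1) = m x + V
  slope : ∀ ⦃a b x y z t : ℝ⦄, a ≤ x → x < y → y ≤ b → a ≤ z → z < t → t ≤ b →
    (F y - F x) * (t - z) ≤ Real.exp (m b - m a) * ((F t - F z) * (y - x))

theorem Distorts.reflect {F m : ℝ → ℝ} {V : ℝ} (h : Distorts F m V) :
    Distorts (reflect F) (reflect m) V := by
  refine ⟨fun x y hxy => neg_le_neg (h.mono (neg_le_neg hxy)), fun x => ?_, ?_⟩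
  · have := h.add_one (-(x + 1))
    simp only [CircleBreak.reflect]
    rw [show -(x + 1) + 1 = -x by ring] at this
    linarith
  · intro a b x y z t h1 h2 h3 h4 h5 h6
    have := h.slope (neg_le_neg h3) (neg_lt_neg h2) (neg_le_neg h1) (neg_le_neg h6)
      (neg_lt_neg h5) (neg_le_neg h4)
    simp only [CircleBreak.reflect]
    convert this using 1
    · ring
    · rw [show -m (-b) - -m (-a) = m (-a) - m (-b) by ring]; ring

/-- Chain rule for difference quotients: the bounds at the successive levels multiply, and the
exponent is the total `m`-mass of the tower over `[a, b]`. -/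
theorem Distorts.iterate {F m : ℝ → ℝ} {V : ℝ} (h : Distorts F m V) (hF : StrictMono F)
    {a b x y z t : ℝ} (hax : a ≤ x) (hxy : x < y) (hyb : y ≤ b) (haz : a ≤ z) (hzt : z < t)
    (htb : t ≤ b) (r : ℕ) :
    (F^[r] y - F^[r] x) * (t - z) ≤
      Real.exp (∑ j ∈ Finset.range r, (m (F^[j] b) - m (F^[j] a))) *
        ((F^[r] t - F^[r] z) * (y - x)) := by
  induction r with
  | zero => simp [mul_comm]
  | succ r ih =>
    have hr := hF.iterate r
    have hs := h.slope (hr.monotone hax) (hr hxy) (hr.monotone hyb) (hr.monotone haz) (hr hzt)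
      (hr.monotone htb)
    simp only [Function.iterate_succ_apply', Finset.sum_range_succ, Real.exp_add] at *
    have hX := sub_pos.2 (hr hxy)
    have hT := sub_pos.2 (hr hzt)
    have hT' := sub_pos.2 (hF (hr hzt))
    have hX' := sub_pos.2 (hF (hr hxy))
    have hmul := mul_le_mul ih hs (mul_pos hX' hT).le
      (mul_pos (Real.exp_pos _) (mul_pos hT (sub_pos.2 hxy))).le
    refine le_of_mul_le_mul_right (le_trans (le_of_eq ?_) (hmul.trans (le_of_eq ?_)))
      (mul_pos hX hT)
    · ring
    · ring

/-! ### The two towers of a pair of return times -/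

/-- The lift `F^q - p` of the `q`-th iterate. -/
def shiftIter (F : ℝ → ℝ) (q : ℕ) (p : ℤ) (x : ℝ) : ℝ := F^[q] x - p

/-- Both sums run along the single orbit of `w`, up to integer translations. The orbit terms cancel
and `(P q - p Q) V = V` remains. With `μ` as a measure of mass `V` on the circle, this says that the
two towers tile it. -/
theorem tower_sum {F μ : ℝ → ℝ} {V : ℝ} (hF : IsLiftFun F) (hμ : ∀ x, μ (x + 1) = μ x + V)
    {q Q : ℕ} {p P : ℤ} (det : P * q - p * Q = 1) (w : ℝ) :
    ∑ j ∈ Finset.range Q, (μ (F^[j] (shiftIter F q p w)) - μ (F^[j] w)) +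
      ∑ j ∈ Finset.range q, (μ (F^[j] w) - μ (F^[j] (shiftIter F Q P w))) = V := by
  have key : ∀ (j n : ℕ) (k : ℤ), μ (F^[j] (shiftIter F n k w)) = μ (F^[n + j] w) - k * V := by
    intro j n k
    have h1 := (hF.iterate j).map_add_int (F^[n] w) (-k)
    have h2 := map_add_intCast hμ (F^[j] (F^[n] w)) (-k)
    push_cast at h1 h2
    rw [shiftIter, sub_eq_add_neg, h1, h2, ← Function.iterate_add_apply, add_comm j n]
    ring
  simp only [key, Finset.sum_sub_distrib, Finset.sum_const, Finset.card_range, nsmul_eq_mul]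
  have e1 := Finset.sum_range_add (fun j => μ (F^[j] w)) q Q
  have e2 := Finset.sum_range_add (fun j => μ (F^[j] w)) Q q
  rw [add_comm Q q] at e2
  have e3 : ((P : ℝ) * q - p * Q) * V = V := by
    have : ((P : ℝ) * q - p * Q) = 1 := by exact_mod_cast det
    rw [this, one_mul]
  linarith

/-- `F^q - p` moves all points to the right, `F^Q - P` moves all points to the left, by a smaller
amount, and the two return times are unimodular. -/
structure ReturnPair (F : ℝ → ℝ) (q Q : ℕ) (p P : ℤ) : Prop where
  det : P * q - p * Q = 1
  le : q ≤ Q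
  right : ∀ x, x < shiftIter F q p x
  left : ∀ x, shiftIter F Q P x < x
  both : ∀ x, x < shiftIter F q p (shiftIter F Q P x)

theorem shiftIter_strictMono {F : ℝ → ℝ} (hF : IsLiftFun F) (q : ℕ) (p : ℤ) :
    StrictMono (shiftIter F q p) := fun _ _ h => sub_lt_sub_right ((hF.iterate q).strictMono h) _

theorem shiftIter_surjective {F : ℝ → ℝ} (hF : IsLiftFun F) (q : ℕ) (p : ℤ) :
    Function.Surjective (shiftIter F q p) := fun y => by
  obtain ⟨x, hx⟩ := (hF.iterate q).surjective (y + p)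
  exact ⟨x, by simp [shiftIter, hx]⟩

theorem iterate_shiftIter {F : ℝ → ℝ} (hF : IsLiftFun F) (j q : ℕ) (p : ℤ) (x : ℝ) :
    F^[j] (shiftIter F q p x) = F^[q + j] x - p := by
  have h1 := (hF.iterate j).map_add_int (F^[q] x) (-p)
  push_cast at h1
  rw [shiftIter, sub_eq_add_neg, h1, ← Function.iterate_add_apply, add_comm j q, ← sub_eq_add_neg]

theorem iterate_shiftIter_comm {F : ℝ → ℝ} (hF : IsLiftFun F) (j q : ℕ) (p : ℤ) (x : ℝ) :
    F^[j] (shiftIter F q p x) = shiftIter F q p (F^[j] x) := by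
  rw [iterate_shiftIter hF, shiftIter, Function.iterate_add_apply]

theorem shiftIter_comm {F : ℝ → ℝ} (hF : IsLiftFun F) (q Q : ℕ) (p P : ℤ) (x : ℝ) :
    shiftIter F Q P (shiftIter F q p x) = shiftIter F q p (shiftIter F Q P x) := by
  have h := fun n m (k : ℤ) => iterate_shiftIter hF n m k x
  rw [shiftIter, h, shiftIter, h, add_comm q Q]; ring

namespace ReturnPair

variable {F : ℝ → ℝ} {q Q : ℕ} {p P : ℤ}

theorem main_sum_le (hR : ReturnPair F q Q p P) (hF : IsLiftFun F) {μ : ℝ → ℝ} {V : ℝ}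
    (hm : Monotone μ) (hμ : ∀ x, μ (x + 1) = μ x + V) (w : ℝ) {r : ℕ} (hr : r ≤ Q) :
    ∑ j ∈ Finset.range r, (μ (F^[j] (shiftIter F q p w)) - μ (F^[j] w)) ≤ V := by
  have h := tower_sum hF hμ hR.det w
  have h2 : 0 ≤ ∑ j ∈ Finset.range q, (μ (F^[j] w) - μ (F^[j] (shiftIter F Q P w))) :=
    Finset.sum_nonneg fun j _ => sub_nonneg.2 (hm ((hF.iterate j).strictMono (hR.left w)).le)
  have h3 : ∑ j ∈ Finset.range r, (μ (F^[j] (shiftIter F q p w)) - μ (F^[j] w)) ≤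
      ∑ j ∈ Finset.range Q, (μ (F^[j] (shiftIter F q p w)) - μ (F^[j] w)) :=
    Finset.sum_le_sum_of_subset_of_nonneg (Finset.range_mono hr) fun j _ _ =>
      sub_nonneg.2 (hm ((hF.iterate j).strictMono (hR.right w)).le)
  linarith

theorem residual_sum_le (hR : ReturnPair F q Q p P) (hF : IsLiftFun F) {μ : ℝ → ℝ} {V : ℝ}
    (hm : Monotone μ) (hμ : ∀ x, μ (x + 1) = μ x + V) (w : ℝ) :
    ∑ j ∈ Finset.range q, (μ (F^[j] w) - μ (F^[j] (shiftIter F Q P w))) ≤ V := by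
  have h := tower_sum hF hμ hR.det w
  have h2 : 0 ≤ ∑ j ∈ Finset.range Q, (μ (F^[j] (shiftIter F q p w)) - μ (F^[j] w)) :=
    Finset.sum_nonneg fun j _ => sub_nonneg.2 (hm ((hF.iterate j).strictMono (hR.right w)).le)
  linarith

/-- Denjoy's inequality: taking `μ = m` in `main_sum_le` bounds the exponent of `Distorts.iterate`
by `V`. -/
theorem slope_le (hR : ReturnPair F q Q p P) (hF : IsLiftFun F) {m : ℝ → ℝ} {V : ℝ}
    (hD : Distorts F m V) {w x y z t : ℝ} {r : ℕ} (hr : r ≤ Q) (hx : w ≤ x) (hxy : x < y)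
    (hy : y ≤ shiftIter F q p w) (hz : w ≤ z) (hzt : z < t) (ht : t ≤ shiftIter F q p w) :
    (F^[r] y - F^[r] x) / (y - x) ≤ Real.exp V * ((F^[r] t - F^[r] z) / (t - z)) := by
  have h := hD.iterate hF.strictMono hx hxy hy hz hzt ht r
  have h1 := Real.exp_le_exp.2 (hR.main_sum_le hF hD.mono hD.add_one w hr)
  have hT := sub_pos.2 ((hF.iterate r).strictMono hzt)
  have hX := sub_pos.2 hxy
  have h2 := h.trans (mul_le_mul_of_nonneg_right h1 (mul_pos hT hX).le)
  rw [← mul_div_assoc, div_le_div_iff₀ hX (sub_pos.2 hzt)]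
  linarith

/-- The two intervals share only the point `G w`, so `slope_le` does not compare them directly. The
interval `[v, G v]` with `w < v < G w` overlaps both; the passage takes three comparisons, each
costing `exp V`. -/
theorem slope_adjacent (hR : ReturnPair F q Q p P) (hF : IsLiftFun F) {m : ℝ → ℝ} {V : ℝ}
    (hD : Distorts F m V) (w : ℝ) {r : ℕ} (hr : r ≤ Q) :
    let G := shiftIter F q p
    (F^[r] (G (G w)) - F^[r] (G w)) / (G (G w) - G w) ≤
        Real.exp V ^ 3 * ((F^[r] (G w) - F^[r] w) / (G w - w)) ∧
      (F^[r] (G w) - F^[r] w) / (G w - w) ≤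
        Real.exp V ^ 3 * ((F^[r] (G (G w)) - F^[r] (G w)) / (G (G w) - G w)) := by
  intro G
  have hG : StrictMono G := shiftIter_strictMono hF q p
  have hw : w < G w := hR.right w
  obtain ⟨v, hv1, hv2⟩ := exists_between hw
  have h1 := hG hv1
  have h2 := hG hv2
  have hGw := hG hw
  have e := (Real.exp_pos V).le
  have a1 := hR.slope_le hF hD hr (le_refl (G w)) hGw le_rfl le_rfl h1 h2.le
  have a2 := hR.slope_le hF hD hr hv2.le h1 le_rfl le_rfl hv2 h1.le
  have a3 := hR.slope_le hF hD hr hv1.le hv2 le_rfl le_rfl hw le_rfl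
  have b1 := hR.slope_le hF hD hr (le_refl w) hw le_rfl hv1.le hv2 le_rfl
  have b2 := hR.slope_le hF hD hr le_rfl hv2 h1.le hv2.le h1 le_rfl
  have b3 := hR.slope_le hF hD hr le_rfl h1 h2.le le_rfl hGw (le_refl (G (G w)))
  constructor
  · calc _ ≤ _ := a1
      _ ≤ _ := mul_le_mul_of_nonneg_left (a2.trans (mul_le_mul_of_nonneg_left a3 e)) e
      _ = _ := by ring
  · calc _ ≤ _ := b1
      _ ≤ _ := mul_le_mul_of_nonneg_left (b2.trans (mul_le_mul_of_nonneg_left b3 e)) e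
      _ = _ := by ring

/-- The intervals `[w, G w]` and `[G w, G² w]` have comparable lengths. -/
theorem comparable_step (hR : ReturnPair F q Q p P) (hF : IsLiftFun F) {m : ℝ → ℝ} {V : ℝ}
    (hD : Distorts F m V) (w : ℝ) :
    let G := shiftIter F q p
    G (G w) - G w ≤ 2 * Real.exp V ^ 6 * (G w - w) ∧
      G w - w ≤ 2 * Real.exp V ^ 6 * (G (G w) - G w) := by
  intro G
  have hG : StrictMono G := shiftIter_strictMono hF q p
  set L : ℕ → ℝ → ℝ := fun i x => F^[i] (G x) - F^[i] x with hL
  have hLpos : ∀ i x, 0 < L i x := fun i x => sub_pos.2 ((hF.iterate i).strictMono (hR.right x))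
  have hL0 : ∀ x, L 0 x = G x - x := fun x => rfl
  have hLQ : ∀ i x, L (Q + i) x = L i (F^[Q] x) := fun i x => by
    simp only [hL, G]
    rw [add_comm Q i, Function.iterate_add_apply, Function.iterate_add_apply,
      iterate_shiftIter_comm hF Q]
  have hadj : ∀ x, ∀ i ≤ Q, L i (G x) * L 0 x ≤ Real.exp V ^ 3 * (L i x * L 0 (G x)) ∧
      L i x * L 0 (G x) ≤ Real.exp V ^ 3 * (L i (G x) * L 0 x) := by
    intro x i hi
    have p1 := hLpos 0 x
    have p2 := hLpos 0 (G x)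
    have h : L i (G x) / L 0 (G x) ≤ Real.exp V ^ 3 * (L i x / L 0 x) ∧
        L i x / L 0 x ≤ Real.exp V ^ 3 * (L i (G x) / L 0 (G x)) := hR.slope_adjacent hF hD x hi
    rw [← mul_div_assoc, ← mul_div_assoc, div_le_div_iff₀ p2 p1, div_le_div_iff₀ p1 p2,
      mul_assoc, mul_assoc] at h
    exact h
  have hV : 0 ≤ V := by
    have h1 := hD.add_one 0
    have h2 := hD.mono (show (0 : ℝ) ≤ 0 + 1 by norm_num)
    linarith
  have hE : 1 ≤ Real.exp V ^ 3 := one_le_pow₀ (Real.one_le_exp hV)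
  have hcomm : ∀ x, F^[Q] (G x) = G (F^[Q] x) := fun x => iterate_shiftIter_comm hF Q q p x
  -- A level above `Q` is reached by `F^Q` followed by fewer than `q ≤ Q` steps. Two applications of
  -- `hadj` double the exponent 3.
  have hadj2 : ∀ i < Q + q, L i (G w) * L 0 w ≤ Real.exp V ^ 6 * (L i w * L 0 (G w)) ∧
      L i w * L 0 (G w) ≤ Real.exp V ^ 6 * (L i (G w) * L 0 w) := by
    intro i hi
    have e6 : Real.exp V ^ 6 = Real.exp V ^ 3 * Real.exp V ^ 3 := by ring
    rcases le_or_gt i Q with h | h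
    · have h0 := hadj w i h
      have hp1 := (mul_pos (hLpos i w) (hLpos 0 (G w))).le
      have hp2 := (mul_pos (hLpos i (G w)) (hLpos 0 w)).le
      have : Real.exp V ^ 3 ≤ Real.exp V ^ 6 := by rw [e6]; nlinarith
      exact ⟨h0.1.trans (mul_le_mul_of_nonneg_right this hp1),
        h0.2.trans (mul_le_mul_of_nonneg_right this hp2)⟩
    · obtain ⟨k, rfl⟩ : ∃ k, i = Q + k := ⟨i - Q, by omega⟩
      have hk : k ≤ Q := by have := hR.le; omega
      have h1 := hadj (F^[Q] w) k hk
      have h2 := hadj w Q le_rfl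
      rw [← hcomm, ← hLQ k, ← hLQ k] at h1
      have z1 : L 0 (F^[Q] w) = L Q w := (hLQ 0 w).symm
      have z2 : L 0 (F^[Q] (G w)) = L Q (G w) := (hLQ 0 (G w)).symm
      rw [z1, z2] at h1
      have pa := hLpos (Q + k) w
      have pb := hLpos (Q + k) (G w)
      have pc := hLpos Q w
      have pd := hLpos Q (G w)
      have pe := hLpos 0 w
      have pf := hLpos 0 (G w)
      have E3 : 0 < Real.exp V ^ 3 := by positivity
      constructor
      · have := mul_le_mul h1.1 h2.1 (by positivity) (by positivity)
        refine le_of_mul_le_mul_right (le_trans (le_of_eq ?_) (this.trans (le_of_eq ?_)))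
          (mul_pos pc pd)
        · ring
        · rw [e6]; ring
      · have := mul_le_mul h1.2 h2.2 (by positivity) (by positivity)
        refine le_of_mul_le_mul_right (le_trans (le_of_eq ?_) (this.trans (le_of_eq ?_)))
          (mul_pos pc pd)
        · ring
        · rw [e6]; ring
  have hid : ∀ x : ℝ, (id (x + 1) : ℝ) = id x + 1 := fun x => rfl
  -- Level `Q + j` is the image under `F^j` of `[R x, G (R x)]`, which contains `[R x, x]` by
  -- `both`. These `Q + q` intervals therefore contain the two tiling towers.
  have hS1 : ∀ x, 1 ≤ ∑ i ∈ Finset.range (Q + q), L i x := by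
    intro x
    have h := tower_sum hF hid hR.det x
    rw [Finset.sum_range_add, ← h]
    refine add_le_add le_rfl (Finset.sum_le_sum fun j _ => ?_)
    have h1 : L (Q + j) x = F^[j] (shiftIter F Q P (G x)) - F^[j] (shiftIter F Q P x) := by
      rw [iterate_shiftIter hF j Q P (G x), iterate_shiftIter hF j Q P x]; simp only [hL]; ring
    rw [h1, shiftIter_comm hF]
    simp only [id]
    linarith [(hF.iterate j).strictMono (hR.both x)]
  -- The levels form two main towers, of heights `Q` and `q ≤ Q`, each of total length at most 1.
  have hS2 : ∀ x, ∑ i ∈ Finset.range (Q + q), L i x ≤ 2 := by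
    intro x
    rw [Finset.sum_range_add]
    simp only [hLQ]
    have h1 := hR.main_sum_le hF monotone_id hid x le_rfl
    have h2 := hR.main_sum_le hF monotone_id hid (F^[Q] x) hR.le
    simp only [id] at h1 h2
    simp only [hL, G]
    linarith
  -- Summing the comparison over all levels replaces the image lengths by totals between 1 and 2,
  -- which leaves a comparison of the base lengths alone.
  have s1 : (∑ i ∈ Finset.range (Q + q), L i (G w)) * L 0 w ≤
      Real.exp V ^ 6 * ((∑ i ∈ Finset.range (Q + q), L i w) * L 0 (G w)) := by
    rw [Finset.sum_mul, Finset.sum_mul, Finset.mul_sum]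
    exact Finset.sum_le_sum fun i hi => (hadj2 i (Finset.mem_range.1 hi)).1
  have s2 : (∑ i ∈ Finset.range (Q + q), L i w) * L 0 (G w) ≤
      Real.exp V ^ 6 * ((∑ i ∈ Finset.range (Q + q), L i (G w)) * L 0 w) := by
    rw [Finset.sum_mul, Finset.sum_mul, Finset.mul_sum]
    exact Finset.sum_le_sum fun i hi => (hadj2 i (Finset.mem_range.1 hi)).2
  have p1 := hLpos 0 w
  have p2 := hLpos 0 (G w)
  have E6 : 0 < Real.exp V ^ 6 := by positivity
  rw [← hL0, ← hL0]
  constructor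
  · have t1 := mul_le_mul_of_nonneg_right (hS1 w) p2.le
    have t2 := mul_le_mul_of_nonneg_left (mul_le_mul_of_nonneg_right (hS2 (G w)) p1.le) E6.le
    linarith
  · have t1 := mul_le_mul_of_nonneg_right (hS1 (G w)) p1.le
    have t2 := mul_le_mul_of_nonneg_left (mul_le_mul_of_nonneg_right (hS2 w) p2.le) E6.le
    linarith

end ReturnPair

/-- Pigeonhole: `n + 1` disjoint half-open pieces of equal length cannot all be hit by at most `n`
points. -/
theorem exists_free_Ioc {κ : Type*} [Fintype κ] (T : κ → Set ℝ) (hT : ∀ k, (T k).Subsingleton)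
    {a b : ℝ} (hab : a < b) {n : ℕ} (hn : Fintype.card κ ≤ n) :
    ∃ a' b', a ≤ a' ∧ b' ≤ b ∧ b' - a' = (b - a) / (n + 1) ∧ ∀ k, ∀ t ∈ T k, t ∉ Ioc a' b' := by
  set η := (b - a) / (n + 1) with hη
  have hn1 : (0 : ℝ) < n + 1 := by positivity
  have hη0 : 0 < η := div_pos (sub_pos.2 hab) hn1
  have hηn : η * (n + 1) = b - a := div_mul_cancel₀ _ hn1.ne'
  by_contra hcon
  have hit : ∀ j : Fin (n + 1), ∃ k, ∃ t ∈ T k, t ∈ Ioc (a + j * η) (a + (j + 1) * η) := by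
    intro j
    by_contra hj
    push Not at hj
    refine hcon ⟨a + j * η, a + (j + 1) * η, ?_, ?_, by ring, hj⟩
    · have : 0 ≤ (j : ℝ) * η := by positivity
      linarith
    · have h1 : ((j : ℕ) : ℝ) + 1 ≤ n + 1 := by exact_mod_cast j.2
      nlinarith
  choose k t htk ht using hit
  have hinj : Function.Injective k := by
    intro i j hij
    have h1 : t i = t j := hT (k i) (htk i) (hij ▸ htk j)
    by_contra hne
    have aux : ∀ i j : Fin (n + 1), i < j → t i < t j := by
      intro i j h
      have h2 : ((i : ℕ) : ℝ) + 1 ≤ (j : ℕ) := by exact_mod_cast h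
      have h3 := (ht i).2
      have h4 := (ht j).1
      nlinarith
    rcases lt_or_gt_of_ne hne with h | h
    · exact (aux _ _ h).ne h1
    · exact (aux _ _ h).ne h1.symm
  have := Fintype.card_le_of_injective k hinj
  simp at this
  omega

/-! ### Towers of intervals -/

/-- The intervals `F^j (u, v]`, `j < r`, cover the circle at most once, in the sense that they
have total mass at most that of the circle for every periodic measure. -/
def SmallTower (F : ℝ → ℝ) (r : ℕ) (u v : ℝ) : Prop :=
  ∀ (μ : ℝ → ℝ) (V : ℝ), Monotone μ → (∀ x, μ (x + 1) = μ x + V) →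
    ∑ j ∈ Finset.range r, (μ (F^[j] v) - μ (F^[j] u)) ≤ V

/-- The indices of the points `s i` that the integer translates of `F^j (I)`, `j < r`, cover. -/
def coverIndex {ι : Type*} (F : ℝ → ℝ) (r : ℕ) (I : Set ℝ) (s : ι → ℝ) : Set ι :=
  {i | ∃ j < r, ∃ k : ℤ, ∃ t ∈ I, F^[j] t + k = s i}

/-- The function `⌊x - c⌋` is the distribution function of the counting measure on `c + ℤ`. Testing
a tower against it counts the visits to the circle point `c`. -/
theorem floor_sub_monotone (c : ℝ) : Monotone fun x : ℝ => ((⌊x - c⌋ : ℤ) : ℝ) := fun x y h => by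
  exact Int.cast_le.2 (Int.floor_le_floor (by linarith))

theorem floor_sub_add_one (c x : ℝ) : ((⌊x + 1 - c⌋ : ℤ) : ℝ) = (⌊x - c⌋ : ℤ) + 1 := by
  rw [show x + 1 - c = x - c + 1 by ring, Int.floor_add_one]; push_cast; rfl

theorem floor_sub_gap {x y c : ℝ} {k l : ℤ} (hx : x < c - k) (hy : c - l ≤ y) :
    (k : ℝ) - l + 1 ≤ (⌊y - c⌋ : ℤ) - (⌊x - c⌋ : ℤ) := by
  have h1 : -l ≤ ⌊y - c⌋ := Int.le_floor.2 (by push_cast; linarith)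
  have h2 : ⌊x - c⌋ < -k := Int.floor_lt.2 (by push_cast; linarith)
  have : k - l + 1 ≤ ⌊y - c⌋ - ⌊x - c⌋ := by omega
  exact_mod_cast this

/-- Each visit to `c` contributes at least 1 to a floor sum bounded by 1, which leaves no room for a
second level or a second translate. -/
theorem SmallTower.unique {F : ℝ → ℝ} (hF : IsLiftFun F) {r : ℕ} {u v : ℝ}
    (h : SmallTower F r u v) {t t' c : ℝ} (ht : t ∈ Ioc u v) (ht' : t' ∈ Ioc u v) {j j' : ℕ}
    (hj : j < r) (hj' : j' < r) {k k' : ℤ} (e : F^[j] t + k = c) (e' : F^[j'] t' + k' = c) :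
    j = j' ∧ t = t' := by
  have huv : u ≤ v := ht.1.le.trans ht.2
  have hs := h _ 1 (floor_sub_monotone c) (floor_sub_add_one c)
  have hnn : ∀ i ∈ Finset.range r, (0 : ℝ) ≤ (⌊F^[i] v - c⌋ : ℤ) - (⌊F^[i] u - c⌋ : ℤ) :=
    fun i _ => sub_nonneg.2 (floor_sub_monotone c ((hF.iterate i).strictMono.monotone huv))
  have b1 : F^[j] u < c - k := by have := (hF.iterate j).strictMono ht.1; linarith
  have b2 : c - k ≤ F^[j] v := by have := (hF.iterate j).strictMono.monotone ht.2; linarith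
  have b3 : F^[j'] u < c - k' := by have := (hF.iterate j').strictMono ht'.1; linarith
  have b4 : c - k' ≤ F^[j'] v := by have := (hF.iterate j').strictMono.monotone ht'.2; linarith
  have hjj : j = j' := by
    by_contra hne
    have h1 := Finset.add_le_sum hnn (Finset.mem_range.2 hj) (Finset.mem_range.2 hj') hne
    have h2 := floor_sub_gap b1 b2
    have h3 := floor_sub_gap b3 b4
    linarith
  subst hjj
  refine ⟨rfl, ?_⟩
  have hk : k = k' := by
    have h1 := Finset.single_le_sum hnn (Finset.mem_range.2 hj)
    have h2 := floor_sub_gap b1 b4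
    have h3 := floor_sub_gap b3 b2
    have h4 : (k : ℝ) - k' ≤ 0 := by linarith
    have h5 : (k' : ℝ) - k ≤ 0 := by linarith
    exact_mod_cast le_antisymm (by linarith : (k : ℝ) ≤ k') (by linarith)
  subst hk
  exact (hF.iterate j).strictMono.injective (by linarith)

theorem SmallTower.mono {F : ℝ → ℝ} (hF : IsLiftFun F) {r : ℕ} {u v u' v' : ℝ}
    (h : SmallTower F r u v) (hu : u ≤ u') (hv : v' ≤ v) : SmallTower F r u' v' := by
  intro μ V hm hμ
  refine (Finset.sum_le_sum fun j _ => ?_).trans (h μ V hm hμ)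
  have h1 := hm ((hF.iterate j).strictMono.monotone hu)
  have h2 := hm ((hF.iterate j).strictMono.monotone hv)
  linarith

theorem mem_coverIndex_of_floor {ι : Type*} {F : ℝ → ℝ} (hF : IsLiftFun F) {r : ℕ} {u v : ℝ}
    (s : ι → ℝ) {i : ι} {j : ℕ} (hj : j < r)
    (h : (0 : ℝ) < (⌊F^[j] v - s i⌋ : ℤ) - (⌊F^[j] u - s i⌋ : ℤ)) :
    i ∈ coverIndex F r (Ioc u v) s := by
  obtain ⟨t, ht⟩ := (hF.iterate j).surjective (s i + (⌊F^[j] v - s i⌋ : ℤ))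
  have h1 : ⌊F^[j] u - s i⌋ < ⌊F^[j] v - s i⌋ := by exact_mod_cast sub_pos.1 h
  have h2 := Int.floor_lt.1 h1
  have h3 := Int.floor_le (F^[j] v - s i)
  refine ⟨j, hj, -⌊F^[j] v - s i⌋, t, ⟨?_, ?_⟩, by rw [ht]; push_cast; ring⟩
  · rw [← (hF.iterate j).strictMono.lt_iff_lt, ht]; linarith
  · rw [← (hF.iterate j).strictMono.le_iff_le, ht]; linarith

theorem floor_sum_of_mem_coverIndex {ι : Type*} {F : ℝ → ℝ} (hF : IsLiftFun F) {r : ℕ} {u v : ℝ}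
    (s : ι → ℝ) {i : ι} (h : i ∈ coverIndex F r (Ioc u v) s) :
    (1 : ℝ) ≤ ∑ j ∈ Finset.range r, (((⌊F^[j] v - s i⌋ : ℤ) : ℝ) - (⌊F^[j] u - s i⌋ : ℤ)) := by
  obtain ⟨j, hj, k, t, ht, e⟩ := h
  have huv : u ≤ v := ht.1.le.trans ht.2
  have hnn : ∀ l ∈ Finset.range r, (0 : ℝ) ≤ (⌊F^[l] v - s i⌋ : ℤ) - (⌊F^[l] u - s i⌋ : ℤ) :=
    fun l _ => sub_nonneg.2 (floor_sub_monotone _ ((hF.iterate l).strictMono.monotone huv))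
  have h1 := Finset.single_le_sum hnn (Finset.mem_range.2 hj)
  have b1 : F^[j] u < s i - k := by have := (hF.iterate j).strictMono ht.1; linarith
  have b2 : s i - k ≤ F^[j] v := by have := (hF.iterate j).strictMono.monotone ht.2; linarith
  have h2 := floor_sub_gap b1 b2
  linarith

namespace ReturnPair

variable {F : ℝ → ℝ} {q Q : ℕ} {p P : ℤ}

theorem smallTower_main (hR : ReturnPair F q Q p P) (hF : IsLiftFun F) (w : ℝ) {r : ℕ}
    (hr : r ≤ Q) : SmallTower F r w (shiftIter F q p w) :=
  fun _ _ hm hμ => hR.main_sum_le hF hm hμ w hr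

theorem smallTower_residual (hR : ReturnPair F q Q p P) (hF : IsLiftFun F) (w : ℝ) :
    SmallTower F q (shiftIter F Q P w) w :=
  fun _ _ hm hμ => hR.residual_sum_le hF hm hμ w

/-- Every point is covered by exactly one of the two towers. -/
theorem mem_main_iff_not_mem_residual (hR : ReturnPair F q Q p P) (hF : IsLiftFun F) (w : ℝ)
    {ι : Type*} (s : ι → ℝ) (i : ι) :
    i ∈ coverIndex F Q (Ioc w (shiftIter F q p w)) s ↔
      i ∉ coverIndex F q (Ioc (shiftIter F Q P w) w) s := by
  have hs := tower_sum (μ := fun x => ((⌊x - s i⌋ : ℤ) : ℝ)) hF (floor_sub_add_one (s i))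
    hR.det w
  constructor
  · intro h1 h2
    have := floor_sum_of_mem_coverIndex hF s h1
    have := floor_sum_of_mem_coverIndex hF s h2
    linarith
  · intro h2
    by_contra h1
    have z1 : ∀ j ∈ Finset.range Q, (((⌊F^[j] (shiftIter F q p w) - s i⌋ : ℤ) : ℝ) -
        (⌊F^[j] w - s i⌋ : ℤ)) ≤ 0 := fun j hj => not_lt.1 fun h =>
      h1 (mem_coverIndex_of_floor hF s (Finset.mem_range.1 hj) h)
    have z2 : ∀ j ∈ Finset.range q, (((⌊F^[j] w - s i⌋ : ℤ) : ℝ) -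
        (⌊F^[j] (shiftIter F Q P w) - s i⌋ : ℤ)) ≤ 0 := fun j hj => not_lt.1 fun h =>
      h2 (mem_coverIndex_of_floor hF s (Finset.mem_range.1 hj) h)
    have := Finset.sum_nonpos z1
    have := Finset.sum_nonpos z2
    linarith

end ReturnPair

/-! ### Absence of wandering intervals -/

/-- The first returns to a point become arbitrarily close to it: there is no wandering interval. -/
theorem exists_step_lt {F : ℝ → ℝ} (hF : IsLiftFun F) {m : ℝ → ℝ} {V : ℝ}
    (hD : Distorts F m V) (x₀ : ℝ) {ε : ℝ} (hε : 0 < ε) :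
    ∃ N : ℕ, ∀ (q Q : ℕ) (p P : ℤ), ReturnPair F q Q p P → N ≤ q →
      shiftIter F q p x₀ - x₀ < ε := by
  by_contra hcon
  push Not at hcon
  set a : ℕ → ℝ := fun j => F^[j] (x₀ + ε) - F^[j] x₀ with ha
  have hlt : x₀ < x₀ + ε := by linarith
  have hapos : ∀ j, 0 < a j := fun j => sub_pos.2 ((hF.iterate j).strictMono hlt)
  -- If the steps of `G` stay at least `ε`, then `(x₀, x₀ + ε]` lies under arbitrarily high main
  -- towers, so the lengths of its images are summable.
  have hsum : ∀ N, ∑ j ∈ Finset.range N, a j ≤ 1 := by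
    intro N
    obtain ⟨q, Q, p, P, hR, hN, h⟩ := hcon N
    have h1 := ((hR.smallTower_main hF x₀ (hN.trans hR.le)).mono hF le_rfl
      (by linarith : x₀ + ε ≤ _)) id 1 monotone_id fun x => rfl
    exact h1
  have hsm : Summable a := summable_of_sum_range_le (fun j => (hapos j).le) hsum
  set K : ℝ := 2 * Real.exp V ^ 6 with hK
  have hKpos : 0 < K := by positivity
  have hev := hsm.tendsto_atTop_zero.eventually_lt_const
    (show 0 < ε / (K * Real.exp V) by positivity)
  obtain ⟨N, hN⟩ := eventually_atTop.1 hev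
  obtain ⟨q, Q, p, P, hR, hNq, h⟩ := hcon N
  have h1 := hN q hNq
  have h2 := hR.slope_le hF hD hR.le (le_refl x₀) (hR.right x₀) le_rfl le_rfl hlt (by linarith)
  have h3 := (hR.comparable_step hF hD x₀).2
  rw [iterate_shiftIter_comm hF] at h2
  -- As `G x₀` and `F^q x₀` differ by an integer, the second step of `G` is as long as the image
  -- under `F^q` of the first. That image is small by distortion because `a q` is small, yet it is
  -- comparable to the first step by `comparable_step`.
  have h4 : shiftIter F q p (shiftIter F q p x₀) - shiftIter F q p x₀ =
    shiftIter F q p (F^[q] x₀) - F^[q] x₀ := by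
    have := iterate_shiftIter_comm hF q q p x₀
    simp only [shiftIter] at this ⊢
    have e := (hF.iterate q).map_add_int (F^[q] x₀) (-p)
    push_cast at e
    rw [← sub_eq_add_neg] at e
    linarith
  rw [h4] at h3
  set X := shiftIter F q p x₀ - x₀ with hX
  have hXpos : 0 < X := by linarith
  rw [div_le_iff₀ hXpos, add_sub_cancel_left] at h2
  change X ≤ K * _ at h3
  have h5 : X ≤ K * (Real.exp V * (a q / ε) * X) := h3.trans (mul_le_mul_of_nonneg_left h2 hKpos.le)
  rw [lt_div_iff₀ (by positivity)] at h1
  have h6 : 1 * X ≤ (K * Real.exp V * (a q / ε)) * X := by linarith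
  have h7 := le_of_mul_le_mul_right h6 hXpos
  have h8 : K * Real.exp V * (a q / ε) = a q * (K * Real.exp V) / ε := by ring
  rw [h8, le_div_iff₀ hε] at h7
  linarith

/-! ### Windows of nontrivial weight near the base point -/

/-- A window `(u, v)` near `x₀` whose tower of height `r` covers the points `s i` only inside
`[u', v']`, well away from its ends. The scale at a point `z` is `max |z - x₀| d`. -/
structure GoodWindow {ι : Type*} (F : ℝ → ℝ) (x₀ : ℝ) (s : ι → ℝ) (c C ε : ℝ) (r : ℕ)
    (u v u' v' d : ℝ) : Prop where
  d_pos : 0 < d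
  tower : SmallTower F r u v
  inner : ∀ t ∈ Ioo u v, ∀ i, ∀ j < r, ∀ k : ℤ, F^[j] t + k = s i → t ∈ Icc u' v'
  margin_left : c * max |u' - x₀| d ≤ u' - u
  margin_right : c * max |v' - x₀| d ≤ v - v'
  ret : ∃ k : ℤ, ∀ z ∈ Icc u v, |F^[r] z - k - x₀| ≤ C * max |z - x₀| d
  small : ∀ z ∈ Icc u v, |z - x₀| ≤ ε
  d_le : d ≤ ε

-- The base `w` is the midpoint of a free interval `J = (j₀, j₁]` between `G⁻¹ x₀` and `x₀`. The
-- candidates are `(w, G w)` with `r = Q` and `(R w, w)` with `r = q`. Their ends lie in `J`, `G J`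
-- and `R J`, which supply margins without marked points; since the two towers partition the marked
-- points, one of them has weight different from 1.
set_option maxHeartbeats 2000000 in
theorem ReturnPair.exists_goodWindow {F : ℝ → ℝ} {q Q : ℕ} {p P : ℤ}
    (hR : ReturnPair F q Q p P) (hF : IsLiftFun F) {m : ℝ → ℝ} {V : ℝ} (hD : Distorts F m V)
    {ι : Type*} [Fintype ι] (s β : ι → ℝ) (hβ : ∏ i, β i ≠ 1) {n : ℕ}
    (hn : 2 * Fintype.card ι ≤ n) {K E : ℝ} (hK : K = 2 * Real.exp V ^ 6) (hE : E = Real.exp V)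
    (x₀ : ℝ) :
    ∃ (r : ℕ) (u v u' v' d : ℝ) (S : Finset ι), (r = q ∨ r = Q) ∧
      GoodWindow F x₀ s (1 / (4 * E * (n + 1) ^ 2 * (1 + K) ^ 2)) (1 + E * (1 + K))
        ((1 + K) ^ 2 * (shiftIter F q p x₀ - x₀)) r u v u' v' d ∧
      (∀ i, i ∈ S ↔ i ∈ coverIndex F r (Ioo u v) s) ∧ ∏ i ∈ S, β i ≠ 1 := by
  classical
  have hV : 0 ≤ V := by
    have h1 := hD.add_one 0
    have h2 := hD.mono (show (0 : ℝ) ≤ 0 + 1 by norm_num)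
    linarith
  have hE1 : 1 ≤ E := hE ▸ Real.one_le_exp hV
  have hK2 : 2 ≤ K := by
    have : 1 ≤ E ^ 6 := one_le_pow₀ hE1
    rw [hK, ← hE]; linarith
  set G := shiftIter F q p with hGdef
  set R := shiftIter F Q P with hRdef
  have hG : StrictMono G := shiftIter_strictMono hF q p
  have hRm : StrictMono R := shiftIter_strictMono hF Q P
  obtain ⟨w₀, hw₀⟩ := shiftIter_surjective hF q p x₀
  obtain ⟨w₁, hw₁⟩ := shiftIter_surjective hF q p w₀
  change G w₀ = x₀ at hw₀
  change G w₁ = w₀ at hw₁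
  have hlt₀ : w₀ < x₀ := by have := hR.right w₀; rwa [← hGdef, hw₀] at this
  have hltG : x₀ < G x₀ := hR.right x₀
  set A := x₀ - w₀ with hA
  set B := G x₀ - x₀ with hB
  have hApos : 0 < A := sub_pos.2 hlt₀
  have hBpos : 0 < B := sub_pos.2 hltG
  have hcomp : ∀ w, G (G w) - G w ≤ K * (G w - w) ∧ G w - w ≤ K * (G (G w) - G w) := fun w => by
    rw [hK]; exact hR.comparable_step hF hD w
  have hBA : B ≤ K * A := by have := (hcomp w₀).1; rwa [hw₀] at this
  have hAB : A ≤ K * B := by have := (hcomp w₀).2; rwa [hw₀] at this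
  have hw₁A : w₀ - w₁ ≤ K * A := by have := (hcomp w₁).2; rwa [hw₁, hw₀] at this
  have hK1 : 1 ≤ 1 + K := by linarith
  have hKA : (1 + K) * A = A + K * A := by ring
  have hKB : (1 + K) * B = B + K * B := by ring
  have hB2 : (1 + K) ^ 2 * B = (1 + K) * B + K * ((1 + K) * B) := by ring
  have hKA0 : 0 < K * A := by positivity
  have hKB0 : 0 < K * B := by positivity
  have hKB1 : 0 < K * ((1 + K) * B) := by positivity
  have hA2 : (1 + K) * A ≤ (1 + K) ^ 2 * B := by
    rw [sq, mul_assoc]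
    exact mul_le_mul_of_nonneg_left (by linarith) (by linarith)
  have hslope : ∀ {w x y z t : ℝ} {r : ℕ}, r ≤ Q → w ≤ x → x < y → y ≤ G w → w ≤ z → z < t →
      t ≤ G w → (F^[r] y - F^[r] x) / (y - x) ≤ E * ((F^[r] t - F^[r] z) / (t - z)) := by
    intro w x y z t r hr h1 h2 h3 h4 h5 h6
    rw [hE]; exact hR.slope_le hF hD hr h1 h2 h3 h4 h5 h6
  -- a free interval
  let T : ι × Bool → Set ℝ := fun κ => {t | t ∈ Ioc w₀ x₀ ∧ ∃ j < Q, ∃ k : ℤ,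
    F^[cond κ.2 Q 0 + j] t + k = s κ.1}
  -- The label `false` stands for the levels below `Q`, the label `true` for the next `Q` levels,
  -- seen from `F^Q w₀`. A main tower meets each marked point at most once, which accounts for `2 *
  -- card ι`.
  have hT : ∀ κ, (T κ).Subsingleton := by
    rintro ⟨i, b⟩ t ⟨ht, j, hj, k, e⟩ t' ⟨ht', j', hj', k', e'⟩
    have hst : SmallTower F Q w₀ x₀ := hw₀ ▸ hR.smallTower_main hF w₀ le_rfl
    cases b with
    | false =>
      simp only [cond_false, zero_add] at e e'
      exact (hst.unique hF ht ht' hj hj' e e').2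
    | true =>
      simp only [cond_true, add_comm Q, Function.iterate_add_apply] at e e'
      have h := hR.smallTower_main hF (F^[Q] w₀) (le_refl Q)
      rw [← iterate_shiftIter_comm hF, ← hGdef, hw₀] at h
      have hQ := (hF.iterate Q).strictMono
      exact hQ.injective (h.unique hF ⟨hQ ht.1, hQ.monotone ht.2⟩ ⟨hQ ht'.1, hQ.monotone ht'.2⟩
        hj hj' e e').2
  obtain ⟨j₀, j₁, hj₀, hj₁, hJ, hfree₀⟩ := exists_free_Ioc T hT hlt₀ (n := n) (by
    simpa [mul_comm] using hn)
  -- Freedom up to `Q + q` leaves `G J` free for `Q` steps and `R J` free for `q` steps, exactly the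
  -- heights of the two towers.
  have hfree : ∀ t ∈ Ioc j₀ j₁, ∀ i, ∀ j < Q + q, ∀ k : ℤ, F^[j] t + k ≠ s i := by
    intro t ht i j hj k e
    have htA : t ∈ Ioc w₀ x₀ := ⟨hj₀.trans_lt ht.1, ht.2.trans hj₁⟩
    rcases lt_or_ge j Q with h | h
    · exact hfree₀ (i, false) t ⟨htA, j, h, k, by simpa using e⟩ ht
    · have := hR.le
      refine hfree₀ (i, true) t ⟨htA, j - Q, by omega, k, ?_⟩ ht
      simp only [cond_true]
      rwa [Nat.add_sub_cancel' h]
  have hn1 : (1 : ℝ) ≤ n + 1 := by have : (0 : ℝ) ≤ n := n.cast_nonneg; linarith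
  rw [← hA] at hJ
  set η := A / (n + 1) with hη
  have hη0 : 0 < η := by positivity
  have hηA : η ≤ A := div_le_self hApos.le hn1
  have hAη : A = η * (n + 1) := by rw [hη, div_mul_cancel₀]; positivity
  set w := (j₀ + j₁) / 2 with hw
  have hwj₁ : j₁ - w = η / 2 := by rw [hw]; linarith
  have hwj₀ : w - j₀ = η / 2 := by rw [hw]; linarith
  have hw₀w : w₀ < w := by linarith
  have hwx₀ : w < x₀ := by linarith
  have hwG : w < G w := hR.right w
  have hGw : G w < G x₀ := hG hwx₀
  have hx₀Gw : x₀ < G w := hw₀ ▸ hG hw₀w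
  have hRw : R w < w := hR.left w
  have hGRw : w < G (R w) := hR.both w
  have hw₁R : w₁ < R w := by
    rw [← hG.lt_iff_lt, hw₁]; linarith
  have hwR : w - R w ≤ K * (G w - w) := by
    obtain ⟨w₂, hw₂⟩ := shiftIter_surjective hF q p w
    change G w₂ = w at hw₂
    have h1 := (hcomp w₂).2
    rw [hw₂] at h1
    have : w₂ < R w := by rw [← hG.lt_iff_lt, hw₂]; exact hGRw
    linarith
  have hdist : ∀ z, R w ≤ z → z ≤ G w → |z - x₀| ≤ (1 + K) ^ 2 * B := by
    intro z h1 h2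
    rw [abs_le]
    constructor <;> linarith
  have hcovJ : w ∈ Ioc j₀ j₁ := ⟨by linarith, by linarith⟩
  set c := 1 / (4 * E * (n + 1) ^ 2 * (1 + K) ^ 2) with hc
  have hcpos : 0 < c := by positivity
  -- bounds of the margins
  have hc_of : ∀ X : ℝ, X ≤ (1 + K) * A → c * X ≤ η / (4 * E * (n + 1) * (1 + K)) := by
    intro X hX
    refine (mul_le_mul_of_nonneg_left hX hcpos.le).trans (le_of_eq ?_)
    rw [hc, hAη]
    field_simp
  have hsmall1 : η / (4 * E * (n + 1) * (1 + K)) ≤ η / 2 := by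
    refine div_le_div_of_nonneg_left hη0.le (by norm_num) ?_
    have h1 := one_le_mul_of_one_le_of_one_le (one_le_mul_of_one_le_of_one_le hE1 hn1) hK1
    linarith
  by_cases hmain : ∏ i with i ∈ coverIndex F Q (Ioc w (G w)) s, β i ≠ 1
  -- The return map is `R`, which displaces `x₀` itself by `x₀ - R x₀`; this is taken as the least
  -- scale `d`.
  · refine ⟨Q, w, G w, j₁, G j₀, x₀ - R x₀, Finset.univ.filter (· ∈ coverIndex F Q (Ioc w (G w)) s), Or.inr rfl,
      ?_, ?_, hmain⟩
    · have hd : 0 < x₀ - R x₀ := sub_pos.2 (hR.left x₀)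
      have hdA : x₀ - R x₀ < A := by
        have : w₀ < R x₀ := by
          rw [← hG.lt_iff_lt, hw₀]; exact hR.both x₀
        linarith
      refine ⟨hd, hR.smallTower_main hF w le_rfl, ?_, ?_, ?_, ⟨P, ?_⟩, ?_, ?_⟩
      · intro t ht i j hj k e
        constructor
        · by_contra h
          exact hfree t ⟨by linarith [ht.1], by linarith⟩ i j (by omega) k e
        · by_contra h
          push Not at h
          obtain ⟨t', rfl⟩ := shiftIter_surjective hF q p t
          have h1 : j₀ < t' := hG.lt_iff_lt.1 h
          have h2 : t' < w := hG.lt_iff_lt.1 ht.2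
          rw [iterate_shiftIter hF] at e
          exact hfree t' ⟨h1, by linarith⟩ i (q + j) (by omega) (k - p) (by push_cast; linarith)
      · have h0 : |j₁ - x₀| ≤ A := abs_le.2 ⟨by linarith, by linarith⟩
        rw [hwj₁]
        exact (hc_of _ (max_le (by linarith) (by linarith))).trans hsmall1
      -- The margin is the `G`-image of `[j₀, w]`, and `G` maps `[w₀, x₀]` onto `[x₀, G x₀]`, of
      -- length `B`. By distortion the margin is a definite fraction of `B`.
      · have h1 := hslope hR.le le_rfl hlt₀ hw₀.ge hj₀ (show j₀ < w by linarith)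
          (by rw [hw₀]; linarith)
        have e1 : F^[q] x₀ - F^[q] w₀ = B := by
          have h2 : F^[q] w₀ - p = x₀ := hw₀
          change F^[q] x₀ - F^[q] w₀ = F^[q] x₀ - p - x₀
          linarith
        have e2 : F^[q] w - F^[q] j₀ = G w - G j₀ := by simp only [hGdef, shiftIter]; ring
        rw [e1, e2, hwj₀, ← hA, div_le_iff₀ hApos] at h1
        have h2 : |G j₀ - x₀| ≤ B := by
          have h3 : x₀ ≤ G j₀ := hw₀ ▸ hG.monotone hj₀
          have h4 : G j₀ ≤ G x₀ := hG.monotone (by linarith)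
          exact abs_le.2 ⟨by linarith, by linarith⟩
        have h3 : max |G j₀ - x₀| (x₀ - R x₀) ≤ (1 + K) * B :=
          max_le (by linarith) (by linarith)
        refine (mul_le_mul_of_nonneg_left h3 hcpos.le).trans ?_
        have h4 : B ≤ E * (2 * (n + 1)) * (G w - G j₀) := by
          refine h1.trans (le_of_eq ?_)
          rw [hAη]; field_simp
        have hpos : 0 < G w - G j₀ := sub_pos.2 (hG (by linarith))
        calc c * ((1 + K) * B) ≤ c * ((1 + K) * (E * (2 * (n + 1)) * (G w - G j₀))) := by gcongr
          _ = (G w - G j₀) * (1 / (2 * (n + 1) * (1 + K))) := by rw [hc]; field_simp; ring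
          _ ≤ (G w - G j₀) * 1 := by
              gcongr
              rw [div_le_one (by positivity)]
              have := one_le_mul_of_one_le_of_one_le hn1 hK1; linarith
          _ = _ := mul_one _
      · intro z hz
        change |R z - x₀| ≤ _
        have hRz : R z < z := hR.left z
        have hCC : 1 ≤ 1 + E * (1 + K) := le_add_of_nonneg_right (by positivity)
        have hmax0 : 0 ≤ max |z - x₀| (x₀ - R x₀) := hd.le.trans (le_max_right _ _)
        have hexp : (1 + E * (1 + K)) * max |z - x₀| (x₀ - R x₀) =
          max |z - x₀| (x₀ - R x₀) + E * (1 + K) * max |z - x₀| (x₀ - R x₀) := by ring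
        have hexp0 : 0 ≤ E * (1 + K) * max |z - x₀| (x₀ - R x₀) := by positivity
        have hm1 := le_max_left |z - x₀| (x₀ - R x₀)
        have hm2 := le_max_right |z - x₀| (x₀ - R x₀)
        -- To the right of `x₀`, `R z` is caught between `R x₀` and `z`. To the left, the mean slope
        -- of `R` over the window is at most `1 + K`, and distortion transfers this to `[z, x₀]` at
        -- the cost of `E`.
        rcases le_or_gt x₀ z with h | h
        · have h1 : R x₀ ≤ R z := hRm.monotone h
          have h2 := le_abs_self (z - x₀)
          rw [abs_le]
          constructor <;> linarith
        · have h1 := hslope le_rfl hz.1 h hx₀Gw.le le_rfl hwG le_rfl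
          have e1 : F^[Q] x₀ - F^[Q] z = R x₀ - R z := by simp only [hRdef, shiftIter]; ring
          have e2 : F^[Q] (G w) - F^[Q] w = R (G w) - R w := by simp only [hRdef, shiftIter]; ring
          rw [e1, e2, div_le_iff₀ (sub_pos.2 h)] at h1
          have h2 : (R (G w) - R w) / (G w - w) ≤ 1 + K := by
            rw [div_le_iff₀ (sub_pos.2 hwG)]
            have := hR.left (G w)
            change R (G w) < _ at this
            linarith
          have h3 : R x₀ - R z ≤ E * (1 + K) * (x₀ - z) :=
            h1.trans (mul_le_mul_of_nonneg_right (mul_le_mul_of_nonneg_left h2 (by linarith))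
              (sub_pos.2 h).le)
          have h4 : x₀ - z ≤ max |z - x₀| (x₀ - R x₀) := by
            refine le_trans ?_ hm1; rw [abs_sub_comm]; exact le_abs_self _
          have h5 : E * (1 + K) * (x₀ - z) ≤ E * (1 + K) * max |z - x₀| (x₀ - R x₀) :=
            mul_le_mul_of_nonneg_left h4 (by positivity)
          rw [abs_le]
          constructor <;> linarith
      · intro z hz
        exact hdist z (hRw.le.trans hz.1) hz.2
      · linarith
    · intro i
      simp only [Finset.mem_filter, Finset.mem_univ, true_and]
      constructor
      · rintro ⟨j, hj, k, t, ht, e⟩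
        refine ⟨j, hj, k, t, ⟨ht.1, lt_of_le_of_ne ht.2 ?_⟩, e⟩
        rintro rfl
        rw [iterate_shiftIter hF] at e
        exact hfree w hcovJ i (q + j) (by omega) (k - p) (by push_cast; linarith)
      · rintro ⟨j, hj, k, t, ht, e⟩
        exact ⟨j, hj, k, t, Ioo_subset_Ioc_self ht, e⟩
  · have hres : ∏ i with i ∈ coverIndex F q (Ioc (R w) w) s, β i ≠ 1 := by
      intro h
      refine hβ ?_
      rw [← Finset.prod_filter_mul_prod_filter_not Finset.univ
        (fun i => i ∈ coverIndex F Q (Ioc w (G w)) s), not_not.1 hmain, one_mul, ← h]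
      refine Finset.prod_congr (Finset.filter_congr fun i _ => ?_) fun _ _ => rfl
      rw [hR.mem_main_iff_not_mem_residual hF w s i, not_not]
    -- A product different from 1 is not empty, so `(R w, w]` contains a point leading to a marked
    -- one. Since `(j₀, w]` is free, the residual window cannot be shorter than half of `J`.
    have hRj₀ : R w < j₀ := by
      obtain ⟨i, hi, -⟩ := Finset.exists_ne_one_of_prod_ne_one hres
      obtain ⟨j, hj, k, t, ht, e⟩ := (Finset.mem_filter.1 hi).2
      by_contra h
      exact hfree t ⟨(not_lt.1 h).trans_lt ht.1, by linarith [ht.2]⟩ i j (by omega) k e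
    -- Here the return map `G` sends the window into `[w, G x₀]`, within `A + B` of `x₀`, so this is
    -- the scale `d`.
    refine ⟨q, R w, w, R j₁, j₀, A + B, Finset.univ.filter (· ∈ coverIndex F q (Ioc (R w) w) s), Or.inl rfl,
      ?_, ?_, hres⟩
    · refine ⟨by positivity, hR.smallTower_residual hF w, ?_, ?_, ?_, ⟨p, ?_⟩, ?_, ?_⟩
      · intro t ht i j hj k e
        constructor
        · by_contra h
          push Not at h
          obtain ⟨t', rfl⟩ := shiftIter_surjective hF Q P t
          have h1 : w < t' := hRm.lt_iff_lt.1 ht.1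
          have h2 : t' < j₁ := hRm.lt_iff_lt.1 h
          rw [iterate_shiftIter hF] at e
          exact hfree t' ⟨by linarith, h2.le⟩ i (Q + j) (by omega) (k - P)
            (by push_cast; linarith)
        · by_contra h
          exact hfree t ⟨not_le.1 h, by linarith [ht.2]⟩ i j (by omega) k e
      · have h1 := hslope le_rfl (le_refl w) hwG le_rfl le_rfl (show w < j₁ by linarith)
          (by linarith)
        have e1 : F^[Q] (G w) - F^[Q] w = R (G w) - R w := by simp only [hRdef, shiftIter]; ring
        have e2 : F^[Q] j₁ - F^[Q] w = R j₁ - R w := by simp only [hRdef, shiftIter]; ring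
        rw [e1, e2, hwj₁, div_le_iff₀ (sub_pos.2 hwG)] at h1
        have h2 : w < R (G w) := by
          have := shiftIter_comm hF q Q p P w
          rw [← hGdef, ← hRdef] at this
          rw [this]; exact hGRw
        have h3 : R w < R j₁ := hRm (by linarith)
        have h4 : R j₁ < j₁ := hR.left j₁
        have hpos : 0 < R j₁ - R w := sub_pos.2 h3
        have h5 : max |R j₁ - x₀| (A + B) ≤ (1 + K) * A :=
          max_le (abs_le.2 ⟨by linarith, by linarith⟩) (by linarith)
        refine (hc_of _ h5).trans ?_
        have h6 : G w - w ≤ (1 + K) * A := by linarith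
        have h7 : η / 2 ≤ E * ((R j₁ - R w) / (η / 2)) * ((1 + K) * A) := by
          have h8 : η / 2 ≤ R (G w) - R w := by linarith
          refine h8.trans (h1.trans (mul_le_mul_of_nonneg_left h6 ?_))
          have : 0 ≤ (R j₁ - R w) / (η / 2) := by positivity
          positivity
        have h9 : E * ((R j₁ - R w) / (η / 2)) * ((1 + K) * A) =
            (R j₁ - R w) * (2 * E * (n + 1) * (1 + K)) := by rw [hAη]; field_simp
        rw [h9] at h7
        rw [div_le_iff₀ (by positivity)]
        linarith
      · have h5 : max |j₀ - x₀| (A + B) ≤ (1 + K) * A :=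
          max_le (abs_le.2 ⟨by linarith, by linarith⟩) (by linarith)
        rw [hwj₀]
        exact (hc_of _ h5).trans hsmall1
      · intro z hz
        change |G z - x₀| ≤ _
        have h1 : G (R w) ≤ G z := hG.monotone hz.1
        have h2 : G z ≤ G w := hG.monotone hz.2
        have h3 : A + B ≤ max |z - x₀| (A + B) := le_max_right _ _
        have h4 : |G z - x₀| ≤ A + B := abs_le.2 ⟨by linarith, by linarith⟩
        have hm : max |z - x₀| (A + B) ≤ (1 + E * (1 + K)) * max |z - x₀| (A + B) :=
          le_mul_of_one_le_left (by linarith) (le_add_of_nonneg_right (by positivity))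
        linarith
      · intro z hz
        exact hdist z hz.1 (hz.2.trans hwG.le)
      · linarith
    · intro i
      simp only [Finset.mem_filter, Finset.mem_univ, true_and]
      constructor
      · rintro ⟨j, hj, k, t, ht, e⟩
        refine ⟨j, hj, k, t, ⟨ht.1, lt_of_le_of_ne ht.2 ?_⟩, e⟩
        rintro rfl
        exact hfree _ hcovJ i j (by omega) k e
      · rintro ⟨j, hj, k, t, ht, e⟩
        exact ⟨j, hj, k, t, Ioo_subset_Ioc_self ht, e⟩

/-! ### Choosing a cluster of points -/

/-- `z₁ < z₂ < z₃ < z₄` in `(u, v)`, with lengths proportional to `1 : M : 1` and comparable to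
their distance to `x₀`, such that those among the points `t i`, `i ∈ S`, that lie in `[z₁, z₄]`
are close to `z₂` and to its left, and have a nontrivial product of weights. -/
structure Cluster {ι : Type*} (S : Finset ι) (t β : ι → ℝ) (x₀ d M ζ K u v z₁ z₂ z₃ z₄ : ℝ) :
    Prop where
  left : u < z₁
  right : z₄ < v
  lt : z₁ < z₂
  length_mid : z₃ - z₂ = M * (z₂ - z₁)
  length_right : z₄ - z₃ = z₂ - z₁
  near : ∀ z ∈ Icc z₁ z₄, |z - x₀| ≤ K * (z₂ - z₁)
  d_le : d ≤ K * (z₂ - z₁)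
  close : ∀ i ∈ S, t i ∈ Icc z₁ z₄ → t i ≤ z₂ ∧ z₂ - t i ≤ ζ * (z₂ - z₁)
  prod_ne : ∏ i ∈ S with t i ∈ Icc z₁ z₄, β i ≠ 1

/-- Lifts a cluster found on one side of a gap to the whole set: its window contains none of the
discarded points. -/
theorem Cluster.mono {ι : Type*} {S S' : Finset ι} {t β : ι → ℝ}
    {x₀ d M ζ K K' u v u' v' z₁ z₂ z₃ z₄ : ℝ} (h : Cluster S t β x₀ d M ζ K u v z₁ z₂ z₃ z₄)
    (hK : K ≤ K') (hu : u' ≤ u) (hv : v ≤ v') (hS : S ⊆ S')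
    (hS' : ∀ i ∈ S', t i ∈ Ioo u v → i ∈ S) :
    Cluster S' t β x₀ d M ζ K' u' v' z₁ z₂ z₃ z₄ := by
  have hl := sub_pos.2 h.lt
  have hKl : K * (z₂ - z₁) ≤ K' * (z₂ - z₁) := mul_le_mul_of_nonneg_right hK hl.le
  have hmem : ∀ i ∈ S', t i ∈ Icc z₁ z₄ → i ∈ S := fun i hi ht =>
    hS' i hi ⟨h.left.trans_le ht.1, ht.2.trans_lt h.right⟩
  refine ⟨hu.trans_lt h.left, h.right.trans_le hv, h.lt, h.length_mid, h.length_right,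
    fun z hz => (h.near z hz).trans hKl, h.d_le.trans hKl, fun i hi ht => h.close i (hmem i hi ht) ht,
    ?_⟩
  convert h.prod_ne using 2
  ext i
  simp only [Finset.mem_filter]
  exact ⟨fun hi => ⟨hmem i hi.1 hi.2, hi.2⟩, fun hi => ⟨hS hi.1, hi.2⟩⟩

/-- Induction on the number of points. If they spread little relative to the scale at the leftmost
one, they already form a cluster. Otherwise a gap of definite relative size separates them into two
smaller sets, one of which has nontrivial weight, and the gap serves as its new margin. -/
theorem exists_cluster (n : ℕ) {M ζ : ℝ} (hM : 1 ≤ M) (hζ : 0 < ζ) {c : ℝ} (hc : 0 < c)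
    (hc1 : c ≤ 1) :
    ∃ K : ℝ, ∀ {ι : Type*} (S : Finset ι) (t β : ι → ℝ) (x₀ d u v u' v' : ℝ), S.card ≤ n → 0 < d →
      (∀ i ∈ S, t i ∈ Icc u' v') → c * max |u' - x₀| d ≤ u' - u → c * max |v' - x₀| d ≤ v - v' →
      ∏ i ∈ S, β i ≠ 1 → ∃ z₁ z₂ z₃ z₄, Cluster S t β x₀ d M ζ K u v z₁ z₂ z₃ z₄ := by
  induction n generalizing c with
  | zero =>
    refine ⟨0, fun S t β x₀ d u v u' v' hS _ _ _ _ hprod => ?_⟩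
    rw [Finset.card_eq_zero.1 (Nat.le_zero.1 hS)] at hprod
    simp at hprod
  | succ n ih =>
    -- In units of the scale at the leftmost point: `l` is the length of `[z₁, z₂]`, small enough
    -- for the triple to fit into the margins; `θ ≤ ζ l` is the spread tolerated in a cluster; `η`
    -- is the gap that the pigeonhole gives for `n + 1` points in a stretch of length `θ`.
    set l := c / (8 * (M + 2)) with hl
    have hl0 : 0 < l := by positivity
    have hlc : l * (8 * (M + 2)) = c := div_mul_cancel₀ _ (by positivity)
    set θ := min (ζ * l) l / 2 with hθ
    have hθ0 : 0 < θ := by positivity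
    have hθζ : θ ≤ ζ * l := by
      have := min_le_left (ζ * l) l
      have : 0 < ζ * l := by positivity
      linarith
    have hθl : θ ≤ l / 2 := by
      have := min_le_right (ζ * l) l
      linarith
    set η := θ / (n + 2) with hη
    have hn2 : (0 : ℝ) < n + 2 := by positivity
    have hη0 : 0 < η := by positivity
    have hl24 : l ≤ 1 / 24 := by
      have := mul_le_mul_of_nonneg_left hM hl0.le
      linarith
    have hηθ : η ≤ θ := div_le_self hθ0.le (by have : (0 : ℝ) ≤ n := n.cast_nonneg; linarith)
    obtain ⟨K₀, hK₀⟩ := ih (c := min c (η / 2)) (by positivity) ((min_le_left _ _).trans hc1)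
    refine ⟨max K₀ (4 / l), ?_⟩
    intro ι S t β x₀ d u v u' v' hS hd ht hu hv hprod
    set σ : ℝ → ℝ := fun x => max |x - x₀| d with hσ
    have hσ0 : ∀ x, 0 < σ x := fun x => hd.trans_le (le_max_right _ _)
    -- The scale is 1-Lipschitz, so margins with `c ≤ 1` persist when the ends move inwards to the
    -- extreme points, and nearby points have comparable scales.
    have hσlip : ∀ x y, x ≤ y → σ x ≤ σ y + (y - x) ∧ σ y ≤ σ x + (y - x) := by
      intro x y hxy
      have h1 : |x - x₀| ≤ |y - x₀| + (y - x) := by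
        have := abs_sub_le x y x₀
        rw [abs_sub_comm x y, abs_of_nonneg (sub_nonneg.2 hxy)] at this
        linarith
      have h2 : |y - x₀| ≤ |x - x₀| + (y - x) := by
        have := abs_sub_le y x x₀
        rw [abs_of_nonneg (sub_nonneg.2 hxy)] at this
        linarith
      have m1 := le_max_left |y - x₀| d
      have m2 := le_max_right |y - x₀| d
      have m3 := le_max_left |x - x₀| d
      have m4 := le_max_right |x - x₀| d
      exact ⟨max_le (by simp only [hσ]; linarith) (by simp only [hσ]; linarith),
        max_le (by simp only [hσ]; linarith) (by simp only [hσ]; linarith)⟩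
    have hSne : S.Nonempty := by
      rw [Finset.nonempty_iff_ne_empty]; rintro rfl; simp at hprod
    obtain ⟨i₀, hi₀, hmin⟩ := S.exists_min_image t hSne
    obtain ⟨i₁, hi₁, hmax⟩ := S.exists_max_image t hSne
    set a := t i₀ with ha
    set b := t i₁ with hb
    have hab : a ≤ b := hmin i₁ hi₁
    change c * σ u' ≤ u' - u at hu
    change c * σ v' ≤ v - v' at hv
    have hau : c * σ a ≤ a - u := by
      have h1 := (ht i₀ hi₀).1
      have h2 := (hσlip u' a h1).2
      have h3 := mul_le_mul_of_nonneg_left h2 hc.le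
      have h4 := mul_le_of_le_one_left (sub_nonneg.2 h1) hc1
      linarith
    have hbv : c * σ b ≤ v - b := by
      have h1 := (ht i₁ hi₁).2
      have h2 := (hσlip b v' h1).1
      have h3 := mul_le_mul_of_nonneg_left h2 hc.le
      have h4 := mul_le_of_le_one_left (sub_nonneg.2 h1) hc1
      linarith
    rcases le_or_gt b (a + θ * σ a) with hsmall | hbig
    · set s := σ a with hs
      have hs0 : 0 < s := hσ0 a
      have hls : 0 < l * s := by positivity
      have hbs : s ≤ σ b + θ * s := by have := (hσlip a b hab).1; linarith
      have hθs : θ * s ≤ l * s / 2 := by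
        have := mul_le_mul_of_nonneg_right hθl hs0.le
        linarith
      have hM2 : (M + 2) * (l * s) = c * s / 8 := by rw [← hlc]; ring
      have hls24 : l * s ≤ s / 24 := by
        have := mul_le_mul_of_nonneg_right hl24 hs0.le
        linarith
      have hcs : c * s ≤ 2 * (c * σ b) := by
        have h1 : s ≤ 2 * σ b := by linarith
        linarith [mul_le_mul_of_nonneg_left h1 hc.le]
      have hMl : (M + 2) * (l * s) = M * (l * s) + 2 * (l * s) := by ring
      have hMl' : (M + 1) * (l * s) = M * (l * s) + l * s := by ring
      have hMl0 : 0 < M * (l * s) := by positivity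
      have hcs0 : 0 < c * s := by positivity
      have hcs1 : c * s ≤ s := mul_le_of_le_one_left hs0.le hc1
      refine ⟨b - l * s, b, b + M * (l * s), b + (M + 1) * (l * s), ?_⟩
      have h4 : 4 * s ≤ max K₀ (4 / l) * (b - (b - l * s)) := by
        have : 4 * s = 4 / l * (l * s) := by field_simp
        rw [this, sub_sub_cancel]
        exact mul_le_mul_of_nonneg_right (le_max_right _ _) hls.le
      have hall : ∀ i ∈ S, t i ∈ Icc (b - l * s) (b + (M + 1) * (l * s)) := fun i hi => by
        have h1 := hmin i hi
        have h2 := hmax i hi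
        exact ⟨by linarith, by linarith⟩
      refine ⟨by linarith, by linarith, by linarith, by ring, by ring, ?_, ?_, ?_, ?_⟩
      · intro z hz
        refine le_trans ?_ h4
        have h1 : |a - x₀| ≤ s := le_max_left _ _
        rw [abs_le] at h1 ⊢
        constructor <;> linarith [hz.1, hz.2]
      · have : d ≤ s := le_max_right _ _
        linarith
      · intro i hi _
        refine ⟨hmax i hi, ?_⟩
        have h1 := hmin i hi
        have h2 : θ * s ≤ ζ * l * s := mul_le_mul_of_nonneg_right hθζ hs0.le
        rw [sub_sub_cancel]
        linarith
      · rwa [Finset.filter_true_of_mem hall]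
    · have hs0 : 0 < σ a := hσ0 a
      obtain ⟨g₀, g₁, hg₀, hg₁, hg, hfree⟩ := exists_free_Ioc (fun i : S => {t i})
        (fun _ => subsingleton_singleton) (show a < a + θ * σ a by linarith [mul_pos hθ0 hs0])
        (n := n + 1) (by simpa using hS)
      have hgη : g₁ - g₀ = η * σ a := by rw [hg, hη]; push_cast; ring
      have hg01 : g₀ < g₁ := by have : 0 < η * σ a := by positivity
                                linarith
      have hfree' : ∀ i ∈ S, t i ≤ g₀ ∨ g₁ < t i := by
        intro i hi
        by_contra h
        push Not at h
        exact hfree ⟨i, hi⟩ (t i) rfl ⟨h.1, h.2⟩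
      have hθ1 : θ * σ a ≤ σ a := mul_le_of_le_one_left hs0.le (by linarith)
      have hg0s : η / 2 * σ g₀ ≤ g₁ - g₀ := by
        have := (hσlip a g₀ hg₀).2
        rw [hgη, div_mul_eq_mul_div, div_le_iff₀ two_pos, mul_assoc]
        exact mul_le_mul_of_nonneg_left (by linarith) hη0.le
      have hg1s : η / 2 * σ g₁ ≤ g₁ - g₀ := by
        have := (hσlip a g₁ (hg₀.trans hg01.le)).2
        rw [hgη, div_mul_eq_mul_div, div_le_iff₀ two_pos, mul_assoc]
        exact mul_le_mul_of_nonneg_left (by linarith) hη0.le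
      set c' := min c (η / 2) with hc'
      have hc'1 : ∀ x, c' * σ x ≤ c * σ x := fun x =>
        mul_le_mul_of_nonneg_right (min_le_left _ _) (hσ0 x).le
      have hc'2 : ∀ x, c' * σ x ≤ η / 2 * σ x := fun x =>
        mul_le_mul_of_nonneg_right (min_le_right _ _) (hσ0 x).le
      have hsplit := Finset.prod_filter_mul_prod_filter_not S (fun i => t i ≤ g₀) β
      have hcard := Finset.card_filter_add_card_filter_not (s := S) (fun i => t i ≤ g₀)
      -- Both parts are nonempty, so each has at most `n` points and the induction hypothesis
      -- applies.
      have hc1 : 0 < (S.filter fun i => t i ≤ g₀).card :=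
        Finset.card_pos.2 ⟨i₀, Finset.mem_filter.2 ⟨hi₀, hg₀⟩⟩
      have hc2 : 0 < (S.filter fun i => ¬ t i ≤ g₀).card :=
        Finset.card_pos.2 ⟨i₁, Finset.mem_filter.2 ⟨hi₁, by rw [not_le]; linarith⟩⟩
      by_cases h1 : ∏ i ∈ S with t i ≤ g₀, β i ≠ 1
      · obtain ⟨z₁, z₂, z₃, z₄, hz⟩ := hK₀ (S.filter fun i => t i ≤ g₀) t β x₀ d u g₁ u' g₀
          (by omega) hd
          (fun i hi => ⟨(ht i (Finset.mem_filter.1 hi).1).1, (Finset.mem_filter.1 hi).2⟩)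
          ((hc'1 u').trans hu) ((hc'2 g₀).trans hg0s) h1
        refine ⟨z₁, z₂, z₃, z₄, hz.mono (le_max_left _ _) le_rfl ?_ (Finset.filter_subset _ _) ?_⟩
        · have := mul_pos hc (hσ0 b)
          linarith
        · intro i hi hti
          exact Finset.mem_filter.2 ⟨hi, (hfree' i hi).resolve_right (not_lt.2 hti.2.le)⟩
      · have h2 : ∏ i ∈ S with ¬ t i ≤ g₀, β i ≠ 1 := by
          intro h
          rw [not_not.1 h1, h, one_mul] at hsplit
          exact hprod hsplit.symm
        obtain ⟨z₁, z₂, z₃, z₄, hz⟩ := hK₀ (S.filter fun i => ¬ t i ≤ g₀) t β x₀ d g₀ v g₁ v'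
          (by omega) hd
          (fun i hi => ⟨((hfree' i (Finset.mem_filter.1 hi).1).resolve_left
            (Finset.mem_filter.1 hi).2).le, (ht i (Finset.mem_filter.1 hi).1).2⟩)
          ((hc'2 g₁).trans hg1s) ((hc'1 v').trans hv) h2
        refine ⟨z₁, z₂, z₃, z₄, hz.mono (le_max_left _ _) ?_ le_rfl (Finset.filter_subset _ _) ?_⟩
        · have := mul_pos hc (hσ0 a)
          linarith
        · intro i hi hti
          exact Finset.mem_filter.2 ⟨hi, not_le.2 hti.1⟩

/-! ### Convergents and return pairs -/

/-- Induction through `ξ = ⌊ξ⌋ + 1 / g`: a convergent `p / q` of `g` yields `(⌊ξ⌋ p + q) / p`, and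
the approximation error is multiplied by `-fract ξ`, which flips the signs. Numerators turn into
denominators; hence the last clause, used for `g > 1`. -/
theorem convergent_pair (n : ℕ) {ξ : ℝ} (hξ : Irrational ξ) :
    ∃ p q p' q' : ℤ, ξ.convergent n = p / q ∧ ξ.convergent (n + 1) = p' / q' ∧
      p' * q - p * q' = (-1) ^ n ∧ 0 < q ∧ q ≤ q' ∧ (0 < n → q < q') ∧
      0 < (-1) ^ n * (q * ξ - p) ∧ (-1) ^ n * (q' * ξ - p') < 0 ∧
      0 < (-1) ^ n * ((q * ξ - p) + (q' * ξ - p')) ∧ (1 < ξ → 0 < p ∧ p < p') := by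
  induction n generalizing ξ with
  | zero =>
    have hf0 : 0 < Int.fract ξ := (Int.fract_pos).2 (by exact_mod_cast hξ.ne_int ⌊ξ⌋)
    have hf1 := Int.fract_lt_one ξ
    have hirr : Irrational (Int.fract ξ)⁻¹ := by
      have : Irrational (Int.fract ξ) := by rw [Int.fract]; exact hξ.sub_intCast _
      exact this.inv
    set g := (Int.fract ξ)⁻¹ with hg
    have hg1 : 1 < g := (one_lt_inv₀ hf0).2 hf1
    have hfg : Int.fract ξ * g = 1 := mul_inv_cancel₀ hf0.ne'
    have ha1 : 1 ≤ ⌊g⌋ := Int.le_floor.2 (by exact_mod_cast hg1.le)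
    have ha2 : (⌊g⌋ : ℝ) < g := lt_of_le_of_ne (Int.floor_le g) (hirr.ne_int _).symm
    have ha3 : g < ⌊g⌋ + 1 := Int.lt_floor_add_one g
    have hξf : ξ = ⌊ξ⌋ + Int.fract ξ := (Int.floor_add_fract ξ).symm
    have haq : (⌊g⌋ : ℚ) ≠ 0 := by have : ⌊g⌋ ≠ 0 := by omega
                                   exact_mod_cast this
    refine ⟨⌊ξ⌋, 1, ⌊ξ⌋ * ⌊g⌋ + 1, ⌊g⌋, by simp, ?_, by ring, one_pos, ha1, by simp, ?_, ?_, ?_, ?_⟩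
    · rw [Real.convergent_succ, Real.convergent_zero, ← hg]
      push_cast
      field_simp
    · push_cast; nlinarith
    · push_cast
      have : (⌊g⌋ : ℝ) * ξ = ⌊ξ⌋ * ⌊g⌋ + Int.fract ξ * ⌊g⌋ := by nth_rw 1 [hξf]; ring
      rw [this]
      nlinarith
    · push_cast
      have : (⌊g⌋ : ℝ) * ξ = ⌊ξ⌋ * ⌊g⌋ + Int.fract ξ * ⌊g⌋ := by nth_rw 1 [hξf]; ring
      rw [this]
      nlinarith
    · intro h
      have : 1 ≤ ⌊ξ⌋ := Int.le_floor.2 (by exact_mod_cast h.le)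
      exact ⟨by omega, by nlinarith⟩
  | succ n ih =>
    have hf0 : 0 < Int.fract ξ := (Int.fract_pos).2 (by exact_mod_cast hξ.ne_int ⌊ξ⌋)
    have hf1 := Int.fract_lt_one ξ
    have hirr : Irrational (Int.fract ξ)⁻¹ := by
      have : Irrational (Int.fract ξ) := by rw [Int.fract]; exact hξ.sub_intCast _
      exact this.inv
    obtain ⟨p, q, p', q', h1, h2, h3, h4, h5, -, h7, h8, h9, h10⟩ := ih hirr
    set g := (Int.fract ξ)⁻¹ with hg
    have hg1 : 1 < g := (one_lt_inv₀ hf0).2 hf1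
    have hfg : Int.fract ξ * g = 1 := mul_inv_cancel₀ hf0.ne'
    have hξf : ξ = ⌊ξ⌋ + Int.fract ξ := (Int.floor_add_fract ξ).symm
    obtain ⟨hp, hpp'⟩ := h10 hg1
    have key : ∀ a b : ℤ, (a : ℝ) * ξ - (⌊ξ⌋ * a + b) = -Int.fract ξ * (b * g - a) := by
      intro a b
      have : -Int.fract ξ * (b * g - a) = -(Int.fract ξ * g) * b + Int.fract ξ * a := by ring
      rw [this, hfg]
      nth_rw 1 [hξf]; ring
    have conv : ∀ a b : ℤ, 0 < a → 0 < b →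
        (⌊ξ⌋ : ℚ) + ((a : ℚ) / b)⁻¹ = ((⌊ξ⌋ * a + b : ℤ) : ℚ) / (a : ℤ) := by
      intro a b ha hb
      have : (a : ℚ) ≠ 0 := by exact_mod_cast ha.ne'
      rw [inv_div]; push_cast; field_simp
    refine ⟨⌊ξ⌋ * p + q, p, ⌊ξ⌋ * p' + q', p', ?_, ?_, ?_, hp, hpp'.le, fun _ => hpp', ?_, ?_, ?_, ?_⟩
    · rw [Real.convergent_succ, ← hg, h1, conv p q hp h4]
    · rw [Real.convergent_succ, ← hg, h2, conv p' q' (hp.trans hpp') (h4.trans_le h5)]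
    · rw [pow_succ]; linear_combination -h3
    · push_cast
      rw [key, pow_succ]
      have := mul_pos hf0 h7
      linarith
    · push_cast
      rw [key, pow_succ]
      have := mul_neg_of_pos_of_neg hf0 h8
      linarith
    · push_cast
      rw [key, key, pow_succ]
      have := mul_pos hf0 h9
      linarith
    · intro h
      have : 1 ≤ ⌊ξ⌋ := Int.le_floor.2 (by exact_mod_cast h.le)
      exact ⟨by nlinarith, by nlinarith⟩

theorem convergent_den_eq {ξ : ℝ} {n : ℕ} {p q a b : ℤ} (h : ξ.convergent n = p / q) (hq : 0 < q)
    (hdet : a * q + b * p = 1) : ((cfDenom ξ n : ℕ) : ℤ) = q := by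
  rw [cfDenom, h]
  refine Rat.den_div_eq_of_coprime hq ?_
  exact Int.isCoprime_iff_nat_coprime.1 ⟨b, a, by linarith⟩

theorem exists_convergent_numerators {ρ : ℝ} (hρ : Irrational ρ) (n : ℕ) :
    ∃ p p' : ℤ, p' * cfDenom ρ n - p * cfDenom ρ (n + 1) = (-1) ^ n ∧
      cfDenom ρ n ≤ cfDenom ρ (n + 1) ∧ (0 < n → cfDenom ρ n < cfDenom ρ (n + 1)) ∧
      0 < (-1) ^ n * (cfDenom ρ n * ρ - p) ∧ (-1) ^ n * (cfDenom ρ (n + 1) * ρ - p') < 0 ∧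
      0 < (-1) ^ n * ((cfDenom ρ n * ρ - p) + (cfDenom ρ (n + 1) * ρ - p')) := by
  obtain ⟨p, q, p', q', h1, h2, h3, h4, h5, h6, h7, h8, h9, -⟩ := convergent_pair n hρ
  have hsq : ((-1 : ℤ) ^ n) * (-1) ^ n = 1 := by rw [← mul_pow]; simp
  have e1 := convergent_den_eq (a := (-1) ^ n * p') (b := -(-1) ^ n * q') h1 h4
    (by linear_combination (-1) ^ n * h3 + hsq)
  have e2 := convergent_den_eq (a := -(-1) ^ n * p) (b := (-1) ^ n * q) h2 (h4.trans_le h5)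
    (by linear_combination (-1) ^ n * h3 + hsq)
  have r1 : (cfDenom ρ n : ℝ) = q := by exact_mod_cast congrArg (fun z : ℤ => (z : ℝ)) e1
  have r2 : (cfDenom ρ (n + 1) : ℝ) = q' := by exact_mod_cast congrArg (fun z : ℤ => (z : ℝ)) e2
  refine ⟨p, p', by rw [e1, e2]; exact h3, by omega, fun h => by have := h6 h; omega, ?_, ?_, ?_⟩
  · rw [r1]; exact h7
  · rw [r2]; exact h8
  · rw [r1, r2]; exact h9

theorem tendsto_cfDenom {ρ : ℝ} (hρ : Irrational ρ) : Tendsto (cfDenom ρ) atTop atTop := by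
  have h : ∀ n, n ≤ cfDenom ρ (n + 1) := by
    intro n
    induction n with
    | zero => simp
    | succ n ih =>
      obtain ⟨_, _, -, -, h, -⟩ := exists_convergent_numerators hρ (n + 1)
      have := h n.succ_pos
      omega
  exact (tendsto_add_atTop_iff_nat 1).1 (tendsto_atTop_mono h tendsto_id)

/-- The sign of the approximation error alternates with `n`, so parity decides between `F` and its
reflection. The integer part of the translation number only shifts `p` and `P`, which preserves the
determinant. -/
theorem exists_returnPair {F : CircleDeg1Lift} (hF : IsLiftFun F) {ρ : ℝ} (hρ : Irrational ρ)
    (h : rotationNumber F = ρ) (n : ℕ) :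
    ∃ p P : ℤ, ReturnPair F (cfDenom ρ n) (cfDenom ρ (n + 1)) p P ∨
      ReturnPair (reflect F) (cfDenom ρ n) (cfDenom ρ (n + 1)) p P := by
  obtain ⟨p, p', h1, h2, -, h4, h5, h6⟩ := exists_convergent_numerators hρ n
  have hτ : F.translationNumber = ρ + ⌊F.translationNumber⌋ := by
    rw [← h, rotationNumber, Int.fract_add_floor]
  set q := cfDenom ρ n
  set Q := cfDenom ρ (n + 1)
  set T := ⌊F.translationNumber⌋
  have lt_iter : ∀ (k : ℕ) (l : ℤ), (0 : ℝ) < k * ρ - l → ∀ x, x < F^[k] x - (l + k * T : ℤ) := by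
    intro k l hk x
    have := (F ^ k).lt_map_of_int_lt_translationNumber (n := l + k * T) (by
      rw [CircleDeg1Lift.translationNumber_pow, hτ]; push_cast; linarith) x
    rw [CircleDeg1Lift.coe_pow] at this
    linarith
  have iter_lt : ∀ (k : ℕ) (l : ℤ), (k : ℝ) * ρ - l < 0 → ∀ x, F^[k] x - (l + k * T : ℤ) < x := by
    intro k l hk x
    have := (F ^ k).map_lt_of_translationNumber_lt_int (n := l + k * T) (by
      rw [CircleDeg1Lift.translationNumber_pow, hτ]; push_cast; linarith) x
    rw [CircleDeg1Lift.coe_pow] at this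
    linarith
  rcases neg_one_pow_eq_or ℝ n with hn | hn
  · have hnZ : (-1 : ℤ) ^ n = 1 := by exact_mod_cast hn
    rw [hn, one_mul] at h4 h5 h6
    refine ⟨p + q * T, p' + Q * T, Or.inl ⟨?_, h2, lt_iter q p h4, iter_lt Q p' h5, fun x => ?_⟩⟩
    · rw [← hnZ, ← h1]; ring
    · have := lt_iter (Q + q) (p' + p) (by push_cast; linarith) x
      rw [shiftIter, iterate_shiftIter hF]
      push_cast at this ⊢
      linarith
  · have hnZ : (-1 : ℤ) ^ n = -1 := by exact_mod_cast hn
    rw [hn] at h4 h5 h6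
    refine ⟨-(p + q * T), -(p' + Q * T), Or.inr ⟨?_, h2, fun x => ?_, fun x => ?_, fun x => ?_⟩⟩
    · rw [hnZ] at h1
      linear_combination -h1
    · have := iter_lt q p (by linarith) (-x)
      rw [shiftIter, reflect_iterate]
      push_cast at this ⊢
      linarith
    · have := lt_iter Q p' (by linarith) (-x)
      rw [shiftIter, reflect_iterate]
      push_cast at this ⊢
      linarith
    · have := iter_lt (Q + q) (p' + p) (by push_cast; linarith) (-x)
      rw [shiftIter, iterate_shiftIter hF.reflect, reflect_iterate]
      push_cast at this ⊢
      linarith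

/-! ### Points of the circle -/

theorem coe_eq_coe_iff_exists_int {x y : ℝ} :
    (x : UnitAddCircle) = y ↔ ∃ k : ℤ, x = y + k := by
  rw [← sub_eq_zero, ← AddCircle.coe_sub, AddCircle.coe_eq_zero_iff]
  exact exists_congr fun k => by
    rw [zsmul_eq_mul, mul_one]
    exact ⟨fun h => by linarith, fun h => by linarith⟩

theorem coe_equivIco (b : UnitAddCircle) :
    (((AddCircle.equivIco (1 : ℝ) 0 b : ℝ)) : UnitAddCircle) = b :=
  (AddCircle.equivIco (1 : ℝ) 0).symm_apply_apply b

/-! ### Distortion of P-homeomorphisms -/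

/-- Mean value inequality with finitely many exceptional points: after a cut at one of them, the
slope over `[a, b]` is a weighted mean of the slopes of the pieces, so one piece is at least as
steep. -/
theorem exists_slope_le_deriv {F : ℝ → ℝ} (hF : Continuous F) (E : Finset ℝ) {a b : ℝ} (hab : a < b)
    (hd : ∀ x ∈ Ioo a b, x ∉ E → DifferentiableAt ℝ F x) :
    ∃ ξ ∈ Ioo a b, DifferentiableAt ℝ F ξ ∧ (F b - F a) / (b - a) ≤ deriv F ξ := by
  induction E using Finset.induction_on generalizing a b with
  | empty =>
    have hd' : ∀ x ∈ Ioo a b, DifferentiableAt ℝ F x := fun x hx => hd x hx (by simp)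
    obtain ⟨ξ, hξ, h⟩ := exists_deriv_eq_slope F hab hF.continuousOn
      fun x hx => (hd' x hx).differentiableWithinAt
    exact ⟨ξ, hξ, hd' ξ hξ, h.ge⟩
  | insert e E _ ih =>
    by_cases he : e ∈ Ioo a b
    · have h1 := ih he.1 fun x hx hxE => hd x ⟨hx.1, hx.2.trans he.2⟩ (by simp [hxE, hx.2.ne])
      have h2 := ih he.2 fun x hx hxE => hd x ⟨he.1.trans hx.1, hx.2⟩ (by simp [hxE, hx.1.ne'])
      obtain ⟨ξ₁, m₁, d₁, s₁⟩ := h1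
      obtain ⟨ξ₂, m₂, d₂, s₂⟩ := h2
      have hab' := sub_pos.2 hab
      rcases le_or_gt ((F b - F a) / (b - a)) (deriv F ξ₁) with h | h
      · exact ⟨ξ₁, ⟨m₁.1, m₁.2.trans he.2⟩, d₁, h⟩
      · refine ⟨ξ₂, ⟨he.1.trans m₂.1, m₂.2⟩, d₂, s₂.trans' ?_⟩
        have h3 := s₁.trans_lt h
        have e1 := sub_pos.2 he.1
        have e2 := sub_pos.2 he.2
        rw [div_lt_div_iff₀ e1 hab'] at h3
        rw [div_le_div_iff₀ hab' e2]
        nlinarith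
    · refine ih hab fun x hx hxE => hd x hx ?_
      rw [Finset.mem_insert, not_or]
      exact ⟨fun h => he (h ▸ hx), hxE⟩

theorem exists_deriv_le_slope {F : ℝ → ℝ} (hF : Continuous F) (E : Finset ℝ) {a b : ℝ} (hab : a < b)
    (hd : ∀ x ∈ Ioo a b, x ∉ E → DifferentiableAt ℝ F x) :
    ∃ ξ ∈ Ioo a b, DifferentiableAt ℝ F ξ ∧ deriv F ξ ≤ (F b - F a) / (b - a) := by
  obtain ⟨ξ, h1, h2, h3⟩ := exists_slope_le_deriv hF.neg E hab fun x hx hE => (hd x hx hE).neg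
  refine ⟨ξ, h1, by simpa using h2.neg, ?_⟩
  have e : deriv (-F) ξ = -deriv F ξ := deriv.neg
  rw [e, Pi.neg_apply, Pi.neg_apply] at h3
  have : (-F b - -F a) / (b - a) = -((F b - F a) / (b - a)) := by ring
  linarith

section

variable {F : ℝ → ℝ}

theorem IsLiftFun.differentiableAt_add_int (hF : IsLiftFun F) (x : ℝ) (k : ℤ) :
    (DifferentiableAt ℝ F (x + k) ↔ DifferentiableAt ℝ F x) ∧ deriv F (x + k) = deriv F x := by
  have h : (fun y => F (y + k)) = fun y => F y + k := funext fun y => hF.map_add_int y k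
  constructor
  · rw [← differentiableAt_comp_add_const, h]
    exact ⟨fun H => by simpa using H.sub_const (k : ℝ), fun H => H.add_const _⟩
  · rw [← deriv_comp_add_const, h, deriv_add_const]

theorem IsPHomeo.exists_exceptional_finset (hP : IsPHomeo F) (a b : ℝ) :
    ∃ E : Finset ℝ, ∀ x ∈ Ioo a b, x ∉ E → DifferentiableAt ℝ F x := by
  have hfin : {x : ℝ | x ∈ Icc a b ∧ (x : UnitAddCircle) ∈ breakSet F}.Finite := by
    have : {x : ℝ | x ∈ Icc a b ∧ (x : UnitAddCircle) ∈ breakSet F} =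
        ⋃ c ∈ breakSet F, {x : ℝ | x ∈ Icc a b ∧ (x : UnitAddCircle) = c} := by
      ext x; simp
    rw [this]
    refine hP.finite_breakSet.biUnion fun c _ => ?_
    obtain ⟨y, rfl⟩ := QuotientAddGroup.mk_surjective c
    refine ((finite_Icc ⌊a - y⌋ ⌈b - y⌉).image fun k : ℤ => y + k).subset ?_
    rintro x ⟨hx, hxy⟩
    obtain ⟨k, rfl⟩ := coe_eq_coe_iff_exists_int.1 hxy
    refine ⟨k, ⟨?_, ?_⟩, rfl⟩
    · exact Int.cast_le.1 ((Int.floor_le _).trans (by linarith [hx.1]) : ((⌊a - y⌋ : ℤ) : ℝ) ≤ k)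
    · exact Int.cast_le.1 ((show (k : ℝ) ≤ b - y by linarith [hx.2]).trans (Int.le_ceil _))
  refine ⟨hfin.toFinset, fun x hx hE => ?_⟩
  by_contra h
  exact hE (hfin.mem_toFinset.2 ⟨Ioo_subset_Icc_self hx, x, rfl, h⟩)

/-- Within a period, `m` accumulates the variation of `log DF`. The extra `L` per period, a bound
for the oscillation of `log DF`, covers pairs of points in different periods, which the variation
over `[0, 1]` does not compare. The mean value inequalities pass from derivatives to slopes. -/
theorem IsPHomeo.exists_distorts (hF : IsLiftFun F) (hP : IsPHomeo F) :
    ∃ m V, Distorts F m V := by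
  classical
  obtain ⟨c₁, c₂, hc₁, hc₁₂, hb, -⟩ := hP.bounds
  set D : Set ℝ := {x | x ∈ Icc (0 : ℝ) 1 ∧ DifferentiableAt ℝ F x} with hD
  set φ : ℝ → ℝ := fun x => Real.log (deriv F x) with hφ
  have hbv := hP.boundedVariation_log_deriv
  set W := (eVariationOn φ D).toReal with hW
  set L := Real.log c₂ - Real.log c₁ with hL
  have hL0 : 0 ≤ L := sub_nonneg.2 (Real.log_le_log hc₁ hc₁₂.le)
  have hφb : ∀ x, DifferentiableAt ℝ F x → Real.log c₁ ≤ φ x ∧ φ x ≤ Real.log c₂ := fun x hx =>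
    ⟨Real.log_le_log hc₁ (hb x hx).1.le, Real.log_le_log (hc₁.trans (hb x hx).1) (hb x hx).2.le⟩
  set m₀ : ℝ → ℝ := fun t => (eVariationOn φ (D ∩ Icc 0 t)).toReal with hm₀
  have hne : ∀ s ⊆ D, eVariationOn φ s ≠ ⊤ := fun s hs =>
    ne_top_of_le_ne_top hbv (eVariationOn.mono φ hs)
  have hm₀mono : Monotone m₀ := fun s t h =>
    ENNReal.toReal_mono (hne _ inter_subset_left)
      (eVariationOn.mono φ (inter_subset_inter_right _ (Icc_subset_Icc_right h)))
  have hm₀0 : ∀ t, 0 ≤ m₀ t := fun t => ENNReal.toReal_nonneg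
  have hm₀W : ∀ t, m₀ t ≤ W := fun t => ENNReal.toReal_mono hbv (eVariationOn.mono φ inter_subset_left)
  have hm₀φ : ∀ x ∈ D, ∀ y ∈ D, x ≤ y → |φ x - φ y| ≤ m₀ y - m₀ x := by
    intro x hx y hy hxy
    have h1 : eVariationOn φ (D ∩ Icc 0 x) + eVariationOn φ (D ∩ Icc x y) ≤
        eVariationOn φ (D ∩ Icc 0 y) := by
      refine (eVariationOn.add_le_union φ ?_).trans (eVariationOn.mono φ ?_)
      · intro s hs t ht
        exact hs.2.2.trans ht.2.1
      · rintro s (hs | hs)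
        · exact ⟨hs.1, hs.2.1, hs.2.2.trans hxy⟩
        · exact ⟨hs.1, hs.1.1.1, hs.2.2⟩
    have h2 : edist (φ x) (φ y) ≤ eVariationOn φ (D ∩ Icc x y) :=
      eVariationOn.edist_le φ ⟨hx, le_rfl, hxy⟩ ⟨hy, hxy, le_rfl⟩
    have h3 := ENNReal.toReal_mono (hne _ inter_subset_left) h1
    rw [ENNReal.toReal_add (hne _ inter_subset_left) (hne _ inter_subset_left)] at h3
    have h4 := ENNReal.toReal_mono (hne _ inter_subset_left) h2
    rw [edist_dist, ENNReal.toReal_ofReal dist_nonneg, Real.dist_eq] at h4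
    simp only [hm₀]
    linarith
  set m : ℝ → ℝ := fun x => ⌊x⌋ * (W + L) + m₀ (Int.fract x) with hm
  have hW0 : 0 ≤ W := ENNReal.toReal_nonneg
  have hmono : Monotone m := by
    intro x y hxy
    rcases (Int.floor_le_floor hxy).eq_or_lt with h | h
    · simp only [hm, h]
      have : Int.fract x ≤ Int.fract y := by
        rw [Int.fract, Int.fract, h]; linarith
      linarith [hm₀mono this]
    · have h1 : (⌊x⌋ : ℝ) + 1 ≤ ⌊y⌋ := by exact_mod_cast h
      have h2 := mul_le_mul_of_nonneg_right h1 (add_nonneg hW0 hL0)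
      simp only [hm]
      linarith [hm₀0 (Int.fract y), hm₀W (Int.fract x)]
  have hfr : ∀ x, DifferentiableAt ℝ F x → Int.fract x ∈ D ∧ φ (Int.fract x) = φ x := by
    intro x hx
    have h := hF.differentiableAt_add_int (Int.fract x) ⌊x⌋
    rw [Int.fract_add_floor] at h
    exact ⟨⟨⟨Int.fract_nonneg x, (Int.fract_lt_one x).le⟩, h.1.1 hx⟩, by simp only [hφ, h.2]⟩
  have hφm : ∀ x y, DifferentiableAt ℝ F x → DifferentiableAt ℝ F y → x ≤ y →
      |φ x - φ y| ≤ m y - m x := by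
    intro x y hx hy hxy
    rcases (Int.floor_le_floor hxy).eq_or_lt with h | h
    · have : Int.fract x ≤ Int.fract y := by
        rw [Int.fract, Int.fract, h]; linarith
      have h1 := hm₀φ _ (hfr x hx).1 _ (hfr y hy).1 this
      rw [(hfr x hx).2, (hfr y hy).2] at h1
      simp only [hm, h]
      linarith
    · have h1 : (⌊x⌋ : ℝ) + 1 ≤ ⌊y⌋ := by exact_mod_cast h
      have h2 := mul_le_mul_of_nonneg_right h1 (add_nonneg hW0 hL0)
      have h3 := hφb x hx
      have h4 := hφb y hy
      have h5 : |φ x - φ y| ≤ L := abs_le.2 ⟨by linarith, by linarith⟩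
      simp only [hm]
      linarith [hm₀0 (Int.fract y), hm₀W (Int.fract x)]
  refine ⟨m, W + L, hmono, fun x => ?_, ?_⟩
  · simp only [hm, Int.floor_add_one, Int.fract_add_one]; push_cast; ring
  · intro a b x y z t hax hxy hyb haz hzt htb
    obtain ⟨E, hE⟩ := hP.exists_exceptional_finset a b
    obtain ⟨ξ, hξ, dξ, h1⟩ := exists_slope_le_deriv hF.continuous E hxy fun s hs =>
      hE s ⟨hax.trans_lt hs.1, hs.2.trans_le hyb⟩
    obtain ⟨η, hη, dη, h2⟩ := exists_deriv_le_slope hF.continuous E hzt fun s hs =>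
      hE s ⟨haz.trans_lt hs.1, hs.2.trans_le htb⟩
    have h3 : |φ ξ - φ η| ≤ m b - m a := by
      have a1 := hmono (hax.trans hξ.1.le)
      have a2 := hmono (hξ.2.le.trans hyb)
      have a3 := hmono (haz.trans hη.1.le)
      have a4 := hmono (hη.2.le.trans htb)
      rcases le_total ξ η with h | h
      · linarith [hφm ξ η dξ dη h]
      · rw [abs_sub_comm]; linarith [hφm η ξ dη dξ h]
    have p1 := hc₁.trans (hb ξ dξ).1
    have p2 := hc₁.trans (hb η dη).1
    have h4 : deriv F ξ ≤ Real.exp (m b - m a) * deriv F η := by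
      rw [← Real.exp_log p1]
      conv_rhs => rw [← Real.exp_log p2]
      rw [← Real.exp_add]
      exact Real.exp_le_exp.2 (by have := (le_abs_self _).trans h3; simp only [hφ] at this; linarith)
    have hxy' := sub_pos.2 hxy
    have hzt' := sub_pos.2 hzt
    rw [div_le_iff₀ hxy'] at h1
    rw [le_div_iff₀ hzt'] at h2
    have e := Real.exp_pos (m b - m a)
    calc (F y - F x) * (t - z) ≤ deriv F ξ * (y - x) * (t - z) := by gcongr
      _ ≤ (Real.exp (m b - m a) * deriv F η) * (y - x) * (t - z) := by gcongr
      _ = Real.exp (m b - m a) * ((deriv F η * (t - z)) * (y - x)) := by ring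
      _ ≤ _ := by gcongr

theorem IsPHomeo.jumpRatio_ne_zero (hF : IsLiftFun F) (hP : IsPHomeo F) {b : UnitAddCircle}
    (hb : b ∈ breakSet F) : jumpRatio F b ≠ 0 := by
  obtain ⟨c₁, c₂, hc₁, -, -, hbr⟩ := hP.bounds
  obtain ⟨y, hy, hnd⟩ := hb
  have hyb := coe_eq_coe_iff_exists_int.1 (hy.trans (coe_equivIco b).symm)
  rw [jumpRatio]
  generalize (AddCircle.equivIco (1 : ℝ) 0 b : ℝ) = x at hyb
  obtain ⟨k, hk⟩ := hyb
  have hxd : ¬ DifferentiableAt ℝ F x := by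
    rwa [hk, (hF.differentiableAt_add_int x k).1] at hnd
  obtain ⟨dl, dr, h1, h2, h3, h4, -⟩ := hbr x hxd
  have e1 := h1.derivWithin (uniqueDiffWithinAt_Iic x)
  have e2 := h2.derivWithin (uniqueDiffWithinAt_Ici x)
  simp only [e1, e2]
  exact div_ne_zero (hc₁.trans h3.1).ne' (hc₁.trans h4.1).ne'

end

/-! ### Coverings for a single lift -/

section

variable {ι : Type*} {F : ℝ → ℝ}

theorem SmallTower.of_reflect {r : ℕ} {u v : ℝ} (h : SmallTower (reflect F) r u v) :
    SmallTower F r (-v) (-u) := by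
  intro μ V hm hμ
  have := h (reflect μ) V (fun x y hxy => neg_le_neg (hm (neg_le_neg hxy))) fun x => by
    have := hμ (-(x + 1))
    rw [show -(x + 1) + 1 = -x by ring] at this
    simp only [reflect]
    linarith
  refine le_of_eq_of_le (Finset.sum_congr rfl fun j _ => ?_) this
  simp only [reflect_iterate, reflect, neg_neg]
  ring

theorem mem_coverIndex_reflect (r : ℕ) (u v : ℝ) (s : ι → ℝ) (i : ι) :
    i ∈ coverIndex (reflect F) r (Ioo u v) (fun i => -s i) ↔
      i ∈ coverIndex F r (Ioo (-v) (-u)) s := by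
  constructor
  · rintro ⟨j, hj, k, t, ht, e⟩
    refine ⟨j, hj, -k, -t, ⟨neg_lt_neg ht.2, neg_lt_neg ht.1⟩, ?_⟩
    rw [reflect_iterate] at e
    push_cast; linarith
  · rintro ⟨j, hj, k, t, ht, e⟩
    refine ⟨j, hj, -k, -t, ⟨lt_neg.1 ht.2, neg_lt.1 ht.1⟩, ?_⟩
    rw [reflect_iterate, neg_neg]
    push_cast; linarith

theorem GoodWindow.of_reflect {x₀ c C ε : ℝ} {s : ι → ℝ} {r : ℕ} {u v u' v' d : ℝ}
    (h : GoodWindow (reflect F) (-x₀) (fun i => -s i) c C ε r u v u' v' d) :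
    GoodWindow F x₀ s c C ε r (-v) (-u) (-v') (-u') d := by
  have habs : ∀ z, |-z - -x₀| = |z - x₀| := fun z => by rw [← abs_neg]; congr 1; ring
  have habs' : ∀ z, |-z - x₀| = |z - -x₀| := fun z => by rw [← abs_neg]; congr 1; ring
  refine ⟨h.d_pos, h.tower.of_reflect, fun t ht i j hj k e => ?_, ?_, ?_, ?_, ?_, h.d_le⟩
  · have := h.inner (-t) ⟨lt_neg.1 ht.2, neg_lt.1 ht.1⟩ i j hj (-k) (by
      rw [reflect_iterate, neg_neg]; push_cast; linarith)
    exact ⟨neg_le.1 this.2, le_neg.1 this.1⟩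
  · have := h.margin_right
    rw [habs']; linarith
  · have := h.margin_left
    rw [habs']; linarith
  · obtain ⟨k, hk⟩ := h.ret
    refine ⟨-k, fun z hz => ?_⟩
    have := hk (-z) ⟨le_neg.1 hz.2, neg_le.1 hz.1⟩
    rw [reflect_iterate, habs, neg_neg] at this
    convert this using 1
    rw [← abs_neg]; congr 1; push_cast; ring
  · intro z hz
    rw [← habs]
    exact h.small (-z) ⟨le_neg.1 hz.2, neg_le.1 hz.1⟩

/-- A triple of intervals near `x₀` whose tower covers the points `s i` only inside the first
interval and close to its right end, the covered ones having a nontrivial product of weights. -/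
structure LiftCovering (F : ℝ → ℝ) (r : ℕ) (x₀ : ℝ) (s β : ι → ℝ) (M ζ K ε z₁ z₂ z₃ z₄ : ℝ) :
    Prop where
  lt : z₁ < z₂
  length_mid : z₃ - z₂ = M * (z₂ - z₁)
  length_right : z₄ - z₃ = z₂ - z₁
  near : ∀ z ∈ Icc z₁ z₄, |z - x₀| ≤ K * (z₂ - z₁) ∧ |z - x₀| ≤ ε
  ret : ∃ k : ℤ, ∀ z ∈ Icc z₁ z₄, |F^[r] z - k - x₀| ≤ K * (z₂ - z₁) ∧ |F^[r] z - k - x₀| ≤ ε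
  tower : ∃ u < z₁, SmallTower F r u z₄
  close : ∀ t ∈ Icc z₁ z₄, ∀ i, ∀ j < r, ∀ k : ℤ, F^[j] t + k = s i →
    t ≤ z₂ ∧ z₂ - t ≤ ζ * (z₂ - z₁)
  prod_ne : ∃ S : Finset ι, (∀ i, i ∈ S ↔ i ∈ coverIndex F r (Icc z₁ z₄) s) ∧ ∏ i ∈ S, β i ≠ 1

/-- Uniqueness in the tower gives each covered index one preimage `t i` in the window. A cluster of
these preimages is then a statement about covered marked points. -/
theorem GoodWindow.exists_liftCovering {x₀ c C ε M ζ K : ℝ} {s β : ι → ℝ} {r : ℕ}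
    {u v u' v' d : ℝ} (hF : IsLiftFun F) (hC : 1 ≤ C)
    (h : GoodWindow F x₀ s c C ε r u v u' v' d) {S : Finset ι}
    (hS : ∀ i, i ∈ S ↔ i ∈ coverIndex F r (Ioo u v) s)
    (hK : ∀ t : ι → ℝ, (∀ i ∈ S, t i ∈ Icc u' v') →
      ∃ z₁ z₂ z₃ z₄, Cluster S t β x₀ d M ζ K u v z₁ z₂ z₃ z₄) (hM : 0 ≤ M) :
    ∃ z₁ z₂ z₃ z₄, LiftCovering F r x₀ s β M ζ (C * K) (C * ε) z₁ z₂ z₃ z₄ := by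
  classical
  have hex : ∀ i, ∃ t, i ∈ S → t ∈ Ioo u v ∧ ∃ j < r, ∃ k : ℤ, F^[j] t + k = s i := by
    intro i
    by_cases hi : i ∈ S
    · obtain ⟨j, hj, k, t, ht, e⟩ := (hS i).1 hi
      exact ⟨t, fun _ => ⟨ht, j, hj, k, e⟩⟩
    · exact ⟨0, fun h => absurd h hi⟩
  choose t ht using hex
  obtain ⟨z₁, z₂, z₃, z₄, hz⟩ := hK t fun i hi => by
    obtain ⟨h1, j, hj, k, e⟩ := ht i hi
    exact h.inner _ h1 i j hj k e
  have hl := sub_pos.2 hz.lt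
  have hl3 : 0 ≤ z₃ - z₂ := by rw [hz.length_mid]; positivity
  have hz14 : z₁ ≤ z₄ := by linarith [hz.length_right]
  have hsub : ∀ z ∈ Icc z₁ z₄, z ∈ Ioo u v := fun z hz' =>
    ⟨hz.left.trans_le hz'.1, hz'.2.trans_lt hz.right⟩
  have hCle : ∀ x : ℝ, 0 ≤ x → x ≤ C * x := fun x hx => le_mul_of_one_le_left hx hC
  have hbase : ∀ y ∈ Icc z₁ z₄, ∀ i, ∀ j < r, ∀ k : ℤ, F^[j] y + k = s i → i ∈ S ∧ t i = y := by
    intro y hy i j hj k e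
    have hi : i ∈ S := (hS i).2 ⟨j, hj, k, y, hsub y hy, e⟩
    obtain ⟨h1, j', hj', k', e'⟩ := ht i hi
    exact ⟨hi, (h.tower.unique hF (Ioo_subset_Ioc_self h1) (Ioo_subset_Ioc_self (hsub y hy))
      hj' hj e' e).2⟩
  refine ⟨z₁, z₂, z₃, z₄, hz.lt, hz.length_mid, hz.length_right, fun z hz' => ?_, ?_, ?_, ?_, ?_⟩
  · have h1 := hz.near z hz'
    have h2 := h.small z (Ioo_subset_Icc_self (hsub z hz'))
    have h3 := abs_nonneg (z - x₀)
    have h4 := hCle _ (h3.trans h1)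
    have h5 := hCle _ (h3.trans h2)
    exact ⟨by linarith, by linarith⟩
  · obtain ⟨k, hk⟩ := h.ret
    refine ⟨k, fun z hz' => ?_⟩
    have h1 := hk z (Ioo_subset_Icc_self (hsub z hz'))
    have h2 := h.small z (Ioo_subset_Icc_self (hsub z hz'))
    have hC0 : 0 ≤ C := by linarith
    rw [mul_assoc]
    exact ⟨h1.trans (mul_le_mul_of_nonneg_left (max_le (hz.near z hz') hz.d_le) hC0),
      h1.trans (mul_le_mul_of_nonneg_left (max_le h2 h.d_le) hC0)⟩
  · exact ⟨u, hz.left, h.tower.mono hF le_rfl hz.right.le⟩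
  · intro y hy i j hj k e
    obtain ⟨hi, rfl⟩ := hbase y hy i j hj k e
    exact hz.close i hi hy
  · refine ⟨S.filter fun i => t i ∈ Icc z₁ z₄, fun i => ?_, hz.prod_ne⟩
    rw [Finset.mem_filter]
    constructor
    · rintro ⟨hi, hti⟩
      obtain ⟨-, j, hj, k, e⟩ := ht i hi
      exact ⟨j, hj, k, t i, hti, e⟩
    · rintro ⟨j, hj, k, y, hy, e⟩
      obtain ⟨hi, rfl⟩ := hbase y hy i j hj k e
      exact ⟨hi, hy⟩

/-- The constant is fixed before the positions `s`, the weights and `x₀`. This order is essential,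
because the marked points coming from `f₂` depend on the conjugacy. -/
theorem eventually_exists_liftCovering {F : CircleDeg1Lift} (hF : IsLiftFun F) {m : ℝ → ℝ} {V : ℝ}
    (hD : Distorts F m V) {ρ : ℝ} (hρ : Irrational ρ) (hFρ : rotationNumber F = ρ)
    (ι : Type*) [Fintype ι] {M ζ : ℝ} (hM : 1 ≤ M) (hζ : 0 < ζ) :
    ∃ K : ℝ, 0 ≤ K ∧ ∀ s β : ι → ℝ, ∏ i, β i ≠ 1 → ∀ x₀ ε : ℝ, 0 < ε → ∀ᶠ n in atTop,
      ∃ (r : ℕ) (z₁ z₂ z₃ z₄ : ℝ), (r = cfDenom ρ (n - 1) ∨ r = cfDenom ρ n) ∧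
        LiftCovering F r x₀ s β M ζ K ε z₁ z₂ z₃ z₄ := by
  set N := 2 * Fintype.card ι with hN
  set A := 2 * Real.exp V ^ 6 with hA
  set E := Real.exp V with hE
  have hV : 0 ≤ V := by
    have h1 := hD.add_one 0
    have h2 := hD.mono (show (0 : ℝ) ≤ 0 + 1 by norm_num)
    linarith
  have hE1 : 1 ≤ E := Real.one_le_exp hV
  have hA0 : 0 < A := by positivity
  have hE0 : 0 < E := by positivity
  set c := 1 / (4 * E * ((N : ℝ) + 1) ^ 2 * (1 + A) ^ 2) with hc
  set C := 1 + E * (1 + A) with hC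
  have hc0 : 0 < c := by positivity
  have hc1 : c ≤ 1 := by
    rw [hc, div_le_one (by positivity)]
    have h1 : 1 ≤ ((N : ℝ) + 1) ^ 2 := one_le_pow₀ (by linarith [(N.cast_nonneg : (0 : ℝ) ≤ N)])
    have h2 : 1 ≤ (1 + A) ^ 2 := one_le_pow₀ (by linarith)
    exact one_le_mul_of_one_le_of_one_le
      (one_le_mul_of_one_le_of_one_le (by linarith) h1) h2
  have hC1 : 1 ≤ C := le_add_of_nonneg_right (by positivity)
  obtain ⟨K₀, hK₀⟩ := exists_cluster (Fintype.card ι) hM hζ hc0 hc1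
  refine ⟨C * max K₀ 0, by positivity, fun s β hβ x₀ ε hε => ?_⟩
  have hε' : 0 < ε / (C * (1 + A) ^ 2) := by positivity
  obtain ⟨N₁, hN₁⟩ := exists_step_lt hF hD x₀ hε'
  obtain ⟨N₂, hN₂⟩ := exists_step_lt hF.reflect hD.reflect (-x₀) hε'
  have hev := ((tendsto_cfDenom hρ).comp (tendsto_sub_atTop_nat 1)).eventually_ge_atTop (max N₁ N₂)
  filter_upwards [hev, eventually_ge_atTop 1] with n hn hn1
  obtain ⟨l, rfl⟩ : ∃ l, n = l + 1 := ⟨n - 1, by omega⟩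
  simp only [Function.comp, Nat.add_sub_cancel] at hn ⊢
  have key : ∀ (r : ℕ) (u v u' v' d ε' : ℝ) (S : Finset ι), ε' < ε / (C * (1 + A) ^ 2) →
      GoodWindow F x₀ s c C ((1 + A) ^ 2 * ε') r u v u' v' d →
      (∀ i, i ∈ S ↔ i ∈ coverIndex F r (Ioo u v) s) → ∏ i ∈ S, β i ≠ 1 →
      ∃ z₁ z₂ z₃ z₄, LiftCovering F r x₀ s β M ζ (C * max K₀ 0) ε z₁ z₂ z₃ z₄ := by
    intro r u v u' v' d ε' S hε' hw hS hprod
    obtain ⟨z₁, z₂, z₃, z₄, hz⟩ := hw.exists_liftCovering (β := β) (K := max K₀ 0) (M := M) (ζ := ζ)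
      hF hC1 hS (fun t ht => by
        obtain ⟨z₁, z₂, z₃, z₄, hz⟩ := hK₀ S t β x₀ d u v u' v' S.card_le_univ hw.d_pos ht
          hw.margin_left hw.margin_right hprod
        exact ⟨z₁, z₂, z₃, z₄, hz.mono (le_max_left _ _) le_rfl le_rfl subset_rfl
          fun i hi _ => hi⟩) (by linarith)
    have hle : C * ((1 + A) ^ 2 * ε') ≤ ε := by
      rw [lt_div_iff₀ (by positivity)] at hε'
      linarith
    obtain ⟨k, hk⟩ := hz.ret
    exact ⟨z₁, z₂, z₃, z₄, hz.lt, hz.length_mid, hz.length_right,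
      fun z hz' => ⟨(hz.near z hz').1, (hz.near z hz').2.trans hle⟩,
      ⟨k, fun z hz' => ⟨(hk z hz').1, (hk z hz').2.trans hle⟩⟩, hz.tower, hz.close, hz.prod_ne⟩
  obtain ⟨p, P, hR | hR⟩ := exists_returnPair hF hρ hFρ l
  · obtain ⟨r, u, v, u', v', d, S, hr, hw, hS, hprod⟩ :=
      hR.exists_goodWindow hF hD s β hβ hN.ge hA hE x₀
    obtain ⟨z₁, z₂, z₃, z₄, hz⟩ := key r u v u' v' d _ S
      (hN₁ _ _ _ _ hR ((le_max_left _ _).trans hn)) hw hS hprod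
    exact ⟨r, z₁, z₂, z₃, z₄, hr, hz⟩
  · obtain ⟨r, u, v, u', v', d, S, hr, hw, hS, hprod⟩ :=
      hR.exists_goodWindow hF.reflect hD.reflect (fun i => -s i) β hβ hN.ge hA hE (-x₀)
    obtain ⟨z₁, z₂, z₃, z₄, hz⟩ := key r (-v) (-u) (-v') (-u') d _ S
      (hN₂ _ _ _ _ hR ((le_max_right _ _).trans hn)) hw.of_reflect
      (fun i => (hS i).trans (mem_coverIndex_reflect r u v s i)) hprod
    exact ⟨r, z₁, z₂, z₃, z₄, hr, hz⟩

end

/-! ### Arcs and lifts -/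

theorem arcLength_coe {x y : ℝ} (h : x ≤ y) (h' : y < x + 1) :
    arcLength (x : UnitAddCircle) y = y - x := by
  rw [arcLength, ← AddCircle.coe_sub]
  refine (AddCircle.coe_equivIco_mk_apply (1 : ℝ) (y - x)).trans ?_
  rw [div_one, mul_one, Int.fract_eq_self.2 ⟨by linarith, by linarith⟩]

theorem arc_coe {x y : ℝ} (h : x ≤ y) (h' : y < x + 1) :
    arc (x : UnitAddCircle) y = (fun t : ℝ => (t : UnitAddCircle)) '' Icc x y := by
  ext z
  rw [arc, mem_ofPred_eq, arcLength_coe h h']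
  constructor
  · intro hz
    refine ⟨x + arcLength x z, ⟨?_, by linarith⟩, ?_⟩
    · linarith [(AddCircle.equivIco (1 : ℝ) 0 (z - x)).2.1,
        show arcLength x z = AddCircle.equivIco (1 : ℝ) 0 (z - x) from rfl]
    · have : ((arcLength x z : ℝ) : UnitAddCircle) = z - x := coe_equivIco _
      simp only [AddCircle.coe_add, this]
      abel
  · rintro ⟨t, ht, rfl⟩
    rw [arcLength_coe ht.1 (ht.2.trans_lt h')]
    linarith [ht.2]

theorem dist_coe_le (x y : ℝ) : dist (x : UnitAddCircle) y ≤ |x - y| := by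
  rw [dist_eq_norm, ← AddCircle.coe_sub, UnitAddCircle.norm_eq]
  simpa using round_le (x - y) 0

theorem dist_coe_le_sub_int (x y : ℝ) (k : ℤ) : dist (x : UnitAddCircle) y ≤ |x - k - y| := by
  have : (x : UnitAddCircle) = ((x - k : ℝ) : UnitAddCircle) :=
    coe_eq_coe_iff_exists_int.2 ⟨k, by ring⟩
  rw [this]; exact dist_coe_le _ _

theorem IsLift.isLiftFun {F : CircleDeg1Lift} {f : UnitAddCircle ≃ₜ UnitAddCircle}
    (h : IsLift F f) : IsLiftFun F := ⟨h.strictMono, h.continuous, F.map_add_one⟩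

theorem iterate_coe {F : ℝ → ℝ} {f : UnitAddCircle → UnitAddCircle}
    (h : ∀ x : ℝ, ((F x : ℝ) : UnitAddCircle) = f x) (j : ℕ) (t : ℝ) :
    f^[j] (t : UnitAddCircle) = (F^[j] t : ℝ) := by
  induction j with
  | zero => rfl
  | succ j ih => rw [Function.iterate_succ_apply', ih, ← h, Function.iterate_succ_apply']

/-- Sufficient conditions for a regular covering, in terms of a lift. The numbers `A` and `V` bound
the ratios of the lengths of the three intervals and the distortion. -/
theorem coversRegularly_of_lift {F m : ℝ → ℝ} {V : ℝ} {f : UnitAddCircle → UnitAddCircle}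
    (hF : IsLiftFun F) (hD : Distorts F m V) (hf : ∀ x : ℝ, ((F x : ℝ) : UnitAddCircle) = f x)
    {r : ℕ} {B : Set UnitAddCircle} {K M A δ ζ x₀ z₁ z₂ z₃ z₄ : ℝ} (h12 : z₁ < z₂) (h23 : z₂ < z₃)
    (h34 : z₃ < z₄) (h41 : z₄ < z₁ + 1) (tower : ∃ u < z₁, SmallTower F r u z₄)
    (hB : ∀ b ∈ B, ∃ j < r, b ∈ f^[j] '' arc z₁ z₄)
    (small : ∀ z ∈ Icc z₁ z₄, |z - x₀| < δ)
    (close : ∀ t ∈ Icc z₁ z₄, ∀ j < r, ((F^[j] t : ℝ) : UnitAddCircle) ∈ B →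
      t ≤ z₂ ∧ z₂ - t < ζ * (z₂ - z₁))
    (hA : 0 ≤ A) (hKA : A * Real.exp V ≤ K)
    (l1 : M * (z₂ - z₁) ≤ z₃ - z₂) (l2 : z₃ - z₂ ≤ A * (z₂ - z₁)) (l3 : z₃ - z₂ ≤ A * (z₄ - z₃))
    (l4 : z₂ - z₁ ≤ A * (z₃ - z₂)) (l5 : z₄ - z₃ ≤ A * (z₃ - z₂)) (l6 : z₂ - z₁ ≤ A * (z₄ - z₃))
    (l7 : z₄ - z₃ ≤ A * (z₂ - z₁))
    (near : ∀ z ∈ Icc z₁ z₄, |z - x₀| ≤ K * (z₂ - z₁))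
    (near' : ∃ k : ℤ, ∀ z ∈ Icc z₁ z₄, |F^[r] z - k - x₀| ≤ K * (z₂ - z₁)) :
    CoversRegularly f r B K M δ ζ x₀ z₁ z₂ z₃ z₄ := by
  obtain ⟨u, hu, htower⟩ := tower
  have hz14 : z₁ ≤ z₄ := by linarith
  have harc := arc_coe hz14 h41
  have hV : 0 ≤ V := by
    have h1 := hD.add_one 0
    have h2 := hD.mono (show (0 : ℝ) ≤ 0 + 1 by norm_num)
    linarith
  have hAK : A ≤ K := (le_mul_of_one_le_right hA (Real.one_le_exp hV)).trans hKA
  -- Small towers concern half-open intervals; the slack `u < z₁` admits the left end of the closed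
  -- arc.
  have hsub : ∀ {t}, t ∈ Icc z₁ z₄ → t ∈ Ioc u z₄ := fun ht => ⟨hu.trans_le ht.1, ht.2⟩
  have hdisj : ∀ i < r, ∀ j < r, i ≠ j →
      Disjoint (f^[i] '' arc z₁ z₄) (f^[j] '' arc z₁ z₄) := by
    intro i hi j hj hij
    rw [disjoint_left, harc]
    rintro _ ⟨_, ⟨t, ht, rfl⟩, rfl⟩ ⟨_, ⟨t', ht', rfl⟩, he⟩
    simp only [iterate_coe hf] at he
    obtain ⟨k, hk⟩ := coe_eq_coe_iff_exists_int.1 he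
    exact hij (htower.unique hF (hsub ht) (hsub ht') hi hj (k := k) (k' := 0) hk.symm (by simp)).1
  have hpre : ∀ b ∈ B, ∀ j < r, ∀ y ∈ arc (z₁ : UnitAddCircle) z₄, f^[j] y = b →
      ∃ t ∈ Icc z₁ z₂, (t : UnitAddCircle) = y ∧ z₂ - t < ζ * (z₂ - z₁) := by
    intro b hb j hj y hy e
    rw [harc] at hy
    obtain ⟨t, ht, rfl⟩ := hy
    simp only [iterate_coe hf] at e
    have h := close t ht j hj (e ▸ hb)
    exact ⟨t, ⟨ht.1, h.1⟩, rfl, h.2⟩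
  have hsum : ∑ j ∈ Finset.range r, (m (F^[j] z₄) - m (F^[j] z₁)) ≤ V :=
    (htower.mono hF hu.le le_rfl) m V hD.mono hD.add_one
  -- Comparability of lengths passes to the images at time `r`: the factor `A` grows by the
  -- distortion `exp V` of the whole tower.
  have himg : ∀ {x y z t : ℝ}, z₁ ≤ x → x < y → y ≤ z₄ → z₁ ≤ z → z < t → t ≤ z₄ →
      y - x ≤ A * (t - z) → F^[r] y - F^[r] x ≤ K * (F^[r] t - F^[r] z) := by
    intro x y z t h1 h2 h3 h4 h5 h6 h7
    have h := hD.iterate hF.strictMono h1 h2 h3 h4 h5 h6 r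
    have hT := sub_pos.2 ((hF.iterate r).strictMono h5)
    have hX := sub_pos.2 h2
    have ht := sub_pos.2 h5
    refine le_of_mul_le_mul_right (h.trans ?_) ht
    calc _ ≤ Real.exp V * ((F^[r] t - F^[r] z) * (A * (t - z))) := by gcongr
      _ = A * Real.exp V * ((F^[r] t - F^[r] z) * (t - z)) := by ring
      _ ≤ K * ((F^[r] t - F^[r] z) * (t - z)) := by gcongr
      _ = _ := by ring
  have hlen : ∀ {x y : ℝ}, z₁ ≤ x → x < y → y ≤ z₄ →
      arcLength (f^[r] x) (f^[r] y) = F^[r] y - F^[r] x := by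
    intro x y h1 h2 h3
    rw [iterate_coe hf, iterate_coe hf, arcLength_coe ((hF.iterate r).strictMono h2).le]
    rw [← (hF.iterate r).map_add_one]
    exact (hF.iterate r).strictMono (by linarith)
  have hKpos : 0 < K := by
    have h1 : 0 < A := by
      by_contra h
      have : A = 0 := le_antisymm (not_lt.1 h) hA
      rw [this] at l2; linarith
    linarith
  have hcomp : ∀ {a b : ℝ}, a ≤ K * b → b ≤ K * a → Comparable K a b := fun h1 h2 =>
    ⟨by rw [inv_mul_le_iff₀ hKpos]; exact h2, h1⟩
  have L12 := arcLength_coe h12.le (by linarith : z₂ < z₁ + 1)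
  have L23 := arcLength_coe h23.le (by linarith : z₃ < z₂ + 1)
  have L34 := arcLength_coe h34.le (by linarith : z₄ < z₃ + 1)
  refine ⟨hdisj, ?_, ?_, ?_, ?_, ?_, ?_, ?_, ?_⟩
  · rw [harc]
    rintro _ ⟨t, ht, rfl⟩
    exact Metric.mem_ball.2 ((dist_coe_le t x₀).trans_lt (small t ht))
  · intro b hb
    obtain ⟨j, hj, hbj⟩ := hB b hb
    refine ⟨j, ⟨hj, hbj⟩, fun i hi => ?_⟩
    by_contra hne
    exact disjoint_left.1 (hdisj i hi.1 j hj hne) hi.2 hbj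
  · intro b hb j hj y hy e
    obtain ⟨t, ht, rfl, -⟩ := hpre b hb j hj y hy e
    rw [arc_coe h12.le (by linarith)]
    exact ⟨t, ht, rfl⟩
  · rw [L12, L23]
    exact ⟨l1, l2.trans (mul_le_mul_of_nonneg_right hAK (by linarith))⟩
  · rw [L23, L34]
    exact hcomp (l3.trans (mul_le_mul_of_nonneg_right hAK (by linarith)))
      (l5.trans (mul_le_mul_of_nonneg_right hAK (by linarith)))
  · rw [hlen le_rfl h12 (by linarith), hlen h12.le h23 h34.le, hlen (by linarith) h34 le_rfl]
    refine ⟨hcomp (himg ?_ ?_ ?_ ?_ ?_ ?_ l4) (himg ?_ ?_ ?_ ?_ ?_ ?_ l2),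
      hcomp (himg ?_ ?_ ?_ ?_ ?_ ?_ l6) (himg ?_ ?_ ?_ ?_ ?_ ?_ l7),
      hcomp (himg ?_ ?_ ?_ ?_ ?_ ?_ l3) (himg ?_ ?_ ?_ ?_ ?_ ?_ l5)⟩ <;> linarith
  · obtain ⟨k, hk⟩ := near'
    have hz : ∀ z ∈ Icc z₁ z₄, dist (f^[r] z) (x₀ : UnitAddCircle) ≤ K * arcLength z₁ z₂ ∧
        dist (z : UnitAddCircle) x₀ ≤ K * arcLength z₁ z₂ := by
      intro z hz
      rw [L12, iterate_coe hf]
      exact ⟨(dist_coe_le_sub_int _ _ k).trans (hk z hz), (dist_coe_le _ _).trans (near z hz)⟩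
    rintro _ (rfl | rfl | rfl | rfl)
    · exact hz _ ⟨le_rfl, hz14⟩
    · exact hz _ ⟨h12.le, by linarith⟩
    · exact hz _ ⟨by linarith, h34.le⟩
    · exact hz _ ⟨hz14, le_rfl⟩
  · intro b hb j hj y hy e
    obtain ⟨t, ht, rfl, h⟩ := hpre b hb j hj y hy e
    rw [L12, arcLength_coe ht.2 (by linarith [ht.1]), div_lt_iff₀ (by linarith)]
    exact h

theorem cyclicallyOrdered_coe {z₁ z₂ z₃ z₄ : ℝ} (h12 : z₁ < z₂) (h23 : z₂ < z₃) (h34 : z₃ < z₄)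
    (h41 : z₄ < z₁ + 1) : CyclicallyOrdered z₁ z₂ z₃ z₄ := by
  rw [CyclicallyOrdered, arcLength_coe h12.le (by linarith),
    arcLength_coe (by linarith) (by linarith), arcLength_coe (by linarith) h41]
  exact ⟨by linarith, by linarith, by linarith⟩

theorem mem_image_iterate_arc_iff {F : ℝ → ℝ} {f : UnitAddCircle → UnitAddCircle}
    (hf : ∀ x : ℝ, ((F x : ℝ) : UnitAddCircle) = f x) {z₁ z₄ : ℝ} (h : z₁ ≤ z₄) (h' : z₄ < z₁ + 1)
    (j : ℕ) (y : ℝ) :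
    (y : UnitAddCircle) ∈ f^[j] '' arc z₁ z₄ ↔ ∃ k : ℤ, ∃ t ∈ Icc z₁ z₄, F^[j] t + k = y := by
  rw [arc_coe h h', image_image]
  simp only [iterate_coe hf]
  constructor
  · rintro ⟨t, ht, e⟩
    obtain ⟨k, hk⟩ := coe_eq_coe_iff_exists_int.1 e.symm
    exact ⟨k, t, ht, hk.symm⟩
  · rintro ⟨k, t, ht, e⟩
    exact ⟨t, ht, (coe_eq_coe_iff_exists_int.2 ⟨k, e.symm⟩).symm⟩

/-! ### Conjugacies -/

/-- `F₂ ∘ H - H ∘ F₁` is continuous and takes integer values, hence is constant. -/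
theorem exists_int_conjugacy {f₁ f₂ h : UnitAddCircle ≃ₜ UnitAddCircle} {F₁ F₂ H : CircleDeg1Lift}
    (hF₁ : IsLift F₁ f₁) (hF₂ : IsLift F₂ f₂) (hH : IsLift H h)
    (hconj : ∀ x, h (f₁ x) = f₂ (h x)) : ∃ k : ℤ, ∀ x, H (F₁ x) = F₂ (H x) - k := by
  have hex : ∀ x : ℝ, ∃ k : ℤ, F₂ (H x) = H (F₁ x) + k := fun x =>
    coe_eq_coe_iff_exists_int.1 (by rw [hF₂.coe_apply, hH.coe_apply, hH.coe_apply, hF₁.coe_apply,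
      hconj])
  have hcont : Continuous fun x => F₂ (H x) - H (F₁ x) :=
    (hF₂.continuous.comp hH.continuous).sub (hH.continuous.comp hF₁.continuous)
  have hdisc : DiscreteTopology (range ((↑) : ℤ → ℝ)) :=
    Int.isClosedEmbedding_coe_real.isEmbedding.toHomeomorph.discreteTopology
  obtain ⟨_, ⟨k, rfl⟩, hk⟩ := isPreconnected_univ.eqOn_const_of_mapsTo (T := range ((↑) : ℤ → ℝ)) ⟨hdisc⟩
    hcont.continuousOn (fun x _ => by
      obtain ⟨k, hk⟩ := hex x
      exact ⟨k, by linarith⟩) ⟨0, 0, by simp⟩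
  refine ⟨k, fun x => ?_⟩
  have := hk (mem_univ x)
  simp only [Function.const] at this
  linarith

/-- The pullback `μ ∘ H` is again a periodic test function. Lengths alone would not be transported
by a mere homeomorphism, whereas the family of all test functions is. -/
theorem SmallTower.conj {F F' H : ℝ → ℝ} (hH : IsLiftFun H) (h : ∀ x, H (F x) = F' (H x))
    {r : ℕ} {u v : ℝ} (ht : SmallTower F r u v) : SmallTower F' r (H u) (H v) := by
  have hit : ∀ j x, F'^[j] (H x) = H (F^[j] x) := fun j x =>
    (Function.Semiconj.iterate_right (f := H) h j x).symm
  intro μ V hm hμ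
  simp only [hit]
  exact ht (μ ∘ H) V (hm.comp hH.strictMono.monotone) fun x => by
    simp only [Function.comp, hH.map_add_one, hμ]

theorem Distorts.sub_const {F m : ℝ → ℝ} {V : ℝ} (h : Distorts F m V) (k : ℝ) :
    Distorts (fun x => F x - k) m V :=
  ⟨h.mono, h.add_one, fun a b x y z t h1 h2 h3 h4 h5 h6 => by
    simpa using h.slope h1 h2 h3 h4 h5 h6⟩

theorem IsLiftFun.sub_const {F : ℝ → ℝ} (h : IsLiftFun F) (k : ℝ) :
    IsLiftFun fun x => F x - k :=
  ⟨fun _ _ hxy => sub_lt_sub_right (h.strictMono hxy) k, h.continuous.sub continuous_const,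
    fun x => by simp only [h.map_add_one]; ring⟩

/-- The disjoint union keeps a break of `f₁` apart from the preimage of a break of `f₂`, even when
they are the same point of the circle. -/
theorem prod_jumpRatio_eq (F₁ F₂ : ℝ → ℝ) {A₁ A₂ : Set UnitAddCircle} (S : Finset (A₁ ⊕ A₂))
    {B₁ B₂ : Set UnitAddCircle} (hB₁ : ∀ b, b ∈ B₁ ↔ ∃ h : b ∈ A₁, Sum.inl ⟨b, h⟩ ∈ S)
    (hB₂ : ∀ b, b ∈ B₂ ↔ ∃ h : b ∈ A₂, Sum.inr ⟨b, h⟩ ∈ S) :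
    ∏ i ∈ S, Sum.elim (fun b : A₁ => jumpRatio F₁ b) (fun b : A₂ => (jumpRatio F₂ b)⁻¹) i =
      jumpProduct F₁ B₁ * (jumpProduct F₂ B₂)⁻¹ := by
  have e₁ : B₁ = (S.toLeft.map ⟨Subtype.val, Subtype.val_injective⟩ : Finset UnitAddCircle) := by
    ext b; simp [hB₁]
  have e₂ : B₂ = (S.toRight.map ⟨Subtype.val, Subtype.val_injective⟩ : Finset UnitAddCircle) := by
    ext b; simp [hB₂]
  rw [jumpProduct, jumpProduct, e₁, e₂, finprod_mem_coe_finset, finprod_mem_coe_finset,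
    Finset.prod_map, Finset.prod_map, ← Finset.prod_inv_distrib]
  conv_lhs => rw [← Finset.toLeft_disjSum_toRight (u := S)]
  rw [Finset.prod_disjSum]
  rfl

theorem jumpProduct_ne_zero {F : ℝ → ℝ} (hF : IsLiftFun F) (hP : IsPHomeo F)
    {B : Set UnitAddCircle} (hB : B ⊆ breakSet F) : jumpProduct F B ≠ 0 := by
  rw [jumpProduct, finprod_mem_eq_finite_toFinset_prod _ (hP.finite_breakSet.subset hB),
    Finset.prod_ne_zero_iff]
  intro b hb
  exact hP.jumpRatio_ne_zero hF (hB ((Set.Finite.mem_toFinset _).1 hb))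

/-- A function with a derivative at `x₀` is uniformly close to an affine one at the scale of an
interval whose length is comparable to its distance to `x₀`. -/
theorem exists_affine_approx {H : ℝ → ℝ} {ω x₀ : ℝ} (hH : HasDerivAt H ω x₀) {e : ℝ} (he : 0 < e) :
    ∃ η > 0, ∀ x, |x - x₀| < η → |H x - H x₀ - ω * (x - x₀)| ≤ e * |x - x₀| := by
  have h := (hasDerivAt_iff_isLittleO.1 hH).def he
  obtain ⟨η, hη, hball⟩ := Metric.eventually_nhds_iff.1 h
  refine ⟨η, hη, fun x hx => ?_⟩
  have := hball (y := x) (by rwa [Real.dist_eq])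
  simpa [Real.norm_eq_abs, smul_eq_mul, mul_comm] using this

end CircleBreak

/-! ### Transfer to the pair of maps -/

set_option maxHeartbeats 1000000 in
theorem theorem4p4
    (f₁ f₂ : UnitAddCircle ≃ₜ UnitAddCircle) (F₁ F₂ : CircleDeg1Lift)
    (hF₁ : CircleBreak.IsLift F₁ f₁) (hF₂ : CircleBreak.IsLift F₂ f₂)
    (hP₁ : CircleBreak.IsPHomeo F₁) (hP₂ : CircleBreak.IsPHomeo F₂)
    (ρ : ℝ) (hρ : Irrational ρ)
    (hρ₁ : CircleBreak.rotationNumber F₁ = ρ) (hρ₂ : CircleBreak.rotationNumber F₂ = ρ)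
    (α : ℝ≥0) (hα : 0 < α)
    (hC₁ : CircleBreak.IsPiecewiseC2Holder α F₁) (hC₂ : CircleBreak.IsPiecewiseC2Holder α F₂)
    (hσ : CircleBreak.jumpProduct F₁ (CircleBreak.breakSet F₁) ≠
      CircleBreak.jumpProduct F₂ (CircleBreak.breakSet F₂))
    (M : ℝ) (hM : 1 ≤ M) (ζ : ℝ) (hζ : ζ ∈ Ioo (0 : ℝ) 1) :
    ∃ K : ℝ, M < K ∧
      ∀ (h : UnitAddCircle ≃ₜ UnitAddCircle) (H : CircleDeg1Lift), CircleBreak.IsLift H h →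
      (∀ x, h (f₁ x) = f₂ (h x)) →
      ∀ x₀ ω₀ : ℝ, HasDerivAt H ω₀ x₀ → 0 < ω₀ →
      ∀ δ ∈ Ioo (0 : ℝ) 1,
      ∀ᶠ n : ℕ in atTop,
        ∃ B₁ ⊆ CircleBreak.breakSet F₁, ∃ B₂ ⊆ CircleBreak.breakSet F₂,
        ∃ (z₁ z₂ z₃ z₄ : UnitAddCircle) (r : ℕ),
          CircleBreak.jumpProduct F₁ B₁ ≠ CircleBreak.jumpProduct F₂ B₂ ∧
          CircleBreak.CyclicallyOrdered z₁ z₂ z₃ z₄ ∧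
          (r = CircleBreak.cfDenom ρ (n - 1) ∨ r = CircleBreak.cfDenom ρ n ∨
            r = CircleBreak.cfDenom ρ n + CircleBreak.cfDenom ρ (n - 1)) ∧
          CircleBreak.CoversPairRegularly f₁ f₂ h r
            (CircleBreak.breakSet F₁) (CircleBreak.breakSet F₂) B₁ B₂
            K M δ ζ (x₀ : UnitAddCircle) z₁ z₂ z₃ z₄ := by
  open CircleBreak in
  classical
  obtain ⟨m₁, V₁, hD₁⟩ := hP₁.exists_distorts hF₁.isLiftFun
  obtain ⟨m₂, V₂, hD₂⟩ := hP₂.exists_distorts hF₂.isLiftFun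
  have : Fintype (breakSet F₁) := hP₁.finite_breakSet.fintype
  have : Fintype (breakSet F₂) := hP₂.finite_breakSet.fintype
  have hζ0 := hζ.1
  have hζ1 := hζ.2
  have hM0 : 0 < M := by linarith
  -- Asking for `2 * M` and `ζ / 4` leaves room for the error in the affine approximation of `H`.
  obtain ⟨K₀, hK₀, hcov⟩ := eventually_exists_liftCovering hF₁.isLiftFun hD₁ hρ hρ₁
    (breakSet F₁ ⊕ breakSet F₂) (M := 2 * M) (ζ := ζ / 4) (by linarith) (by linarith)
  have hE₁ := Real.exp_pos V₁
  have hE₂ := Real.exp_pos V₂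
  have hK1 : 4 * M * Real.exp V₁ ≤ 4 * M * (Real.exp V₁ + Real.exp V₂) + 2 * K₀ + M + 1 := by
    have : 0 < 4 * M * Real.exp V₂ := by positivity
    linarith
  have hK2 : 4 * M * Real.exp V₂ ≤ 4 * M * (Real.exp V₁ + Real.exp V₂) + 2 * K₀ + M + 1 := by
    have : 0 < 4 * M * Real.exp V₁ := by positivity
    linarith
  have hK3 : 2 * K₀ + M < 4 * M * (Real.exp V₁ + Real.exp V₂) + 2 * K₀ + M + 1 := by
    have : 0 < 4 * M * (Real.exp V₁ + Real.exp V₂) := by positivity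
    linarith
  set K := 4 * M * (Real.exp V₁ + Real.exp V₂) + 2 * K₀ + M + 1
  refine ⟨K, by linarith, ?_⟩
  intro h H hH hconj x₀ ω₀ hder hω₀ δ hδ
  obtain ⟨k₀, hk₀⟩ := exists_int_conjugacy hF₁ hF₂ hH hconj
  have hHm := hH.strictMono
  have hHl := hH.isLiftFun
  -- This lift of `f₂` is conjugate to `F₁` by `H` exactly, without an integer shift.
  set F₂' : ℝ → ℝ := fun x => F₂ x - k₀ with hF₂'
  have hF₂'l : IsLiftFun F₂' := hF₂.isLiftFun.sub_const _
  have hD₂' : Distorts F₂' m₂ V₂ := hD₂.sub_const _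
  have hf₂ : ∀ x : ℝ, ((F₂' x : ℝ) : UnitAddCircle) = f₂ x := fun x => by
    rw [← hF₂.coe_apply]
    exact coe_eq_coe_iff_exists_int.2 ⟨-k₀, by simp only [hF₂']; push_cast; ring⟩
  have hit : ∀ j x, F₂'^[j] (H x) = H (F₁^[j] x) := fun j x =>
    ((show Function.Semiconj H F₁ F₂' from hk₀).iterate_right j x).symm
  -- indices and weights
  set s : breakSet F₁ ⊕ breakSet F₂ → ℝ := Sum.elim
    (fun b => AddCircle.equivIco (1 : ℝ) 0 (b : UnitAddCircle))
    (fun b => AddCircle.equivIco (1 : ℝ) 0 (h.symm b)) with hs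
  set β : breakSet F₁ ⊕ breakSet F₂ → ℝ := Sum.elim (fun b => jumpRatio F₁ b)
    (fun b => (jumpRatio F₂ b)⁻¹) with hβ
  have hprod : ∏ i, β i ≠ 1 := by
    rw [hβ, prod_jumpRatio_eq F₁ F₂ Finset.univ (B₁ := breakSet F₁) (B₂ := breakSet F₂)
      (by simp) (by simp), Ne, mul_inv_eq_one₀ (jumpProduct_ne_zero hF₂.isLiftFun hP₂ subset_rfl)]
    exact hσ
  -- scale
  set e := ω₀ * ζ / (16 * (K₀ + 1)) with he
  have he0 : 0 < e := by positivity
  have heK : e * (16 * (K₀ + 1)) = ω₀ * ζ := div_mul_cancel₀ _ (by positivity)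
  obtain ⟨η, hη, happ⟩ := exists_affine_approx hder he0
  -- The bounds serve, in order, the affine approximation, a triple shorter than one period, and the
  -- distance `δ` to `x₀` and to `h x₀`.
  set ε := min (η / 2) (min (1 / 4) (min (δ / 2) (δ / (2 * ω₀)))) with hε
  have hδ0 := hδ.1
  have hε0 : 0 < ε := by positivity
  have hεη : ε < η := (min_le_left _ _).trans_lt (by linarith)
  have hε4 : ε ≤ 1 / 4 := (min_le_right _ _).trans (min_le_left _ _)
  have hεδ : ε < δ :=
    ((min_le_right _ _).trans ((min_le_right _ _).trans (min_le_left _ _))).trans_lt (by linarith)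
  have hεω : 2 * ω₀ * ε ≤ δ := by
    have : ε ≤ δ / (2 * ω₀) :=
      (min_le_right _ _).trans ((min_le_right _ _).trans (min_le_right _ _))
    rw [le_div_iff₀ (by positivity)] at this
    linarith
  filter_upwards [hcov s β hprod x₀ ε hε0] with n hn
  obtain ⟨r, z₁, z₂, z₃, z₄, hr, hz⟩ := hn
  set l := z₂ - z₁ with hl
  have hl0 : 0 < l := sub_pos.2 hz.lt
  have hMl : 0 < M * l := by positivity
  have h23 : z₃ - z₂ = 2 * (M * l) := by rw [hz.length_mid]; ring
  have h34 : z₄ - z₃ = l := hz.length_right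
  have hMl1 : l ≤ M * l := le_mul_of_one_le_left hl0.le hM
  have hMMl : M * l ≤ M * (M * l) := le_mul_of_one_le_left hMl.le hM
  have lt23 : z₂ < z₃ := by linarith
  have lt34 : z₃ < z₄ := by linarith
  have h12 := hz.lt
  have hz14 : z₁ ≤ z₄ := by linarith
  have hI1 : z₁ ∈ Icc z₁ z₄ := ⟨le_rfl, hz14⟩
  have hI2 : z₂ ∈ Icc z₁ z₄ := ⟨h12.le, by linarith⟩
  have hI3 : z₃ ∈ Icc z₁ z₄ := ⟨by linarith, lt34.le⟩
  have hI4 : z₄ ∈ Icc z₁ z₄ := ⟨hz14, le_rfl⟩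
  have h41 : z₄ < z₁ + 1 := by
    have h1 := abs_le.1 (hz.near z₁ hI1).2
    have h2 := abs_le.1 (hz.near z₄ hI4).2
    linarith
  have hH41 : H z₄ < H z₁ + 1 := by rw [← hHl.map_add_one]; exact hHm h41
  have heK0 : e * (K₀ * l) ≤ ω₀ * l * ζ / 16 := by
    have h1 : ω₀ * l * ζ = 16 * (e * (K₀ * l)) + 16 * (e * l) := by
      have : ω₀ * l * ζ = e * (16 * (K₀ + 1)) * l := by rw [heK]; ring
      rw [this]; ring
    have : 0 < e * l := by positivity
    linarith
  have hωl : 0 < ω₀ * l := by positivity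
  have hζl : ω₀ * l * ζ ≤ ω₀ * l := mul_le_of_le_one_right hωl.le hζ1.le
  have hζl0 : 0 < ω₀ * l * ζ := by positivity
  -- `H` is nearly affine on the scale of the triple
  have hdev : ∀ x, |x - x₀| ≤ K₀ * l → |x - x₀| ≤ ε →
      |H x - H x₀ - ω₀ * (x - x₀)| ≤ ω₀ * l * ζ / 16 := fun x h1 h2 =>
    (happ x (h2.trans_lt hεη)).trans ((mul_le_mul_of_nonneg_left h1 he0.le).trans heK0)
  have hdev2 : ∀ x ∈ Icc z₁ z₄, ∀ y ∈ Icc z₁ z₄,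
      |H y - H x - ω₀ * (y - x)| ≤ ω₀ * l * ζ / 8 := by
    intro x hx y hy
    have h1 := abs_le.1 (hdev x (hz.near x hx).1 (hz.near x hx).2)
    have h2 := abs_le.1 (hdev y (hz.near y hy).1 (hz.near y hy).2)
    exact abs_le.2 ⟨by linarith, by linarith⟩
  have d12 := abs_le.1 (hdev2 z₁ hI1 z₂ hI2)
  have d23 := abs_le.1 (hdev2 z₂ hI2 z₃ hI3)
  have d34 := abs_le.1 (hdev2 z₃ hI3 z₄ hI4)
  rw [← hl] at d12
  rw [h23] at d23
  rw [h34] at d34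
  have hL1 : 7 / 8 * (ω₀ * l) ≤ H z₂ - H z₁ := by linarith
  have hL1' : H z₂ - H z₁ ≤ 9 / 8 * (ω₀ * l) := by linarith
  have hL2 : 2 * (ω₀ * (M * l)) - ω₀ * l / 8 ≤ H z₃ - H z₂ := by linarith
  have hL2' : H z₃ - H z₂ ≤ 2 * (ω₀ * (M * l)) + ω₀ * l / 8 := by linarith
  have hL3 : 7 / 8 * (ω₀ * l) ≤ H z₄ - H z₃ := by linarith
  have hL3' : H z₄ - H z₃ ≤ 9 / 8 * (ω₀ * l) := by linarith
  have hωMl : ω₀ * l ≤ ω₀ * (M * l) := mul_le_mul_of_nonneg_left hMl1 hω₀.le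
  have hM12 := mul_le_mul_of_nonneg_left hL1 hM0.le
  have hM12' := mul_le_mul_of_nonneg_left hL1' hM0.le
  have hM34 := mul_le_mul_of_nonneg_left hL3 hM0.le
  have hMe : M * (ω₀ * l) = ω₀ * (M * l) := by ring
  have hM23 : H z₃ - H z₂ ≤ M * (H z₃ - H z₂) := le_mul_of_one_le_left (by linarith) hM
  have hnearH : ∀ x, |x - x₀| ≤ K₀ * l → |x - x₀| ≤ ε → |H x - H x₀| ≤ K * (H z₂ - H z₁) ∧
      |H x - H x₀| < δ := by
    intro x h1 h2
    have h3 := abs_le.1 (happ x (h2.trans_lt hεη))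
    have h4 : e ≤ ω₀ / 16 := by
      rw [he, div_le_div_iff₀ (by positivity) (by norm_num)]
      have : ω₀ * ζ ≤ ω₀ * (K₀ + 1) := mul_le_mul_of_nonneg_left (by linarith) hω₀.le
      linarith
    have h5 : |H x - H x₀| ≤ 17 / 16 * (ω₀ * |x - x₀|) := by
      have h6 := mul_le_mul_of_nonneg_right h4 (abs_nonneg (x - x₀))
      have h7 : |ω₀ * (x - x₀)| = ω₀ * |x - x₀| := by rw [abs_mul, abs_of_pos hω₀]
      have h8 := abs_le.1 h7.le
      exact abs_le.2 ⟨by linarith, by linarith⟩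
    have h6 := mul_le_mul_of_nonneg_left h1 hω₀.le
    have h7 := mul_le_mul_of_nonneg_left h2 hω₀.le
    have h8 : 0 < ω₀ * ε := by positivity
    refine ⟨h5.trans ?_, by linarith⟩
    have h9 : K₀ * (7 / 8 * (ω₀ * l)) ≤ K₀ * (H z₂ - H z₁) := mul_le_mul_of_nonneg_left hL1 hK₀
    have h10 : 2 * K₀ * (H z₂ - H z₁) ≤ K * (H z₂ - H z₁) :=
      mul_le_mul_of_nonneg_right (by linarith) (by linarith)
    have h11 : 0 ≤ ω₀ * (K₀ * l) := by positivity
    linarith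
  obtain ⟨S, hS, hSprod⟩ := hz.prod_ne
  have hcoeH : ∀ z : ℝ, h (z : UnitAddCircle) = (H z : ℝ) := fun z => (hH.coe_apply z).symm
  -- the covered break points
  have hB₁ : ∀ b, b ∈ coveredBy f₁ r z₁ z₄ (breakSet F₁) ↔
      ∃ hb : b ∈ breakSet F₁, Sum.inl ⟨b, hb⟩ ∈ S := by
    intro b
    rw [coveredBy, mem_ofPred_eq, ← exists_prop]
    refine exists_congr fun hb => ?_
    rw [hS]
    refine exists_congr fun j => and_congr_right fun _ => ?_
    conv_lhs => rw [← coe_equivIco b]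
    exact mem_image_iterate_arc_iff hF₁.coe_apply hz14 h41 j _
  have hB₂ : ∀ b, b ∈ coveredBy f₂ r (h z₁) (h z₄) (breakSet F₂) ↔
      ∃ hb : b ∈ breakSet F₂, Sum.inr ⟨b, hb⟩ ∈ S := by
    intro b
    rw [coveredBy, mem_ofPred_eq, ← exists_prop]
    refine exists_congr fun hb => ?_
    rw [hS]
    refine exists_congr fun j => and_congr_right fun _ => ?_
    have e1 : b = (H (AddCircle.equivIco (1 : ℝ) 0 (h.symm b)) : ℝ) := by
      rw [hH.coe_apply, coe_equivIco, h.apply_symm_apply]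
    conv_lhs => rw [e1]
    rw [hcoeH, hcoeH, mem_image_iterate_arc_iff hf₂ (hHm.monotone hz14) hH41]
    refine exists_congr fun k => ?_
    have hk : ∀ t, H (F₁^[j] t) + k = H (F₁^[j] t + k) := fun t => (hHl.map_add_int _ k).symm
    constructor
    · rintro ⟨y, hy, e⟩
      obtain ⟨t, rfl⟩ := hHl.surjective y
      rw [hit, hk] at e
      exact ⟨t, ⟨hHm.le_iff_le.1 hy.1, hHm.le_iff_le.1 hy.2⟩, hHm.injective e⟩
    · rintro ⟨t, ht, e⟩
      refine ⟨H t, ⟨hHm.monotone ht.1, hHm.monotone ht.2⟩, ?_⟩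
      rw [hit, hk, e]
      rfl
  have hsub₁ : coveredBy f₁ r z₁ z₄ (breakSet F₁) ⊆ breakSet F₁ := fun b hb => hb.1
  have hsub₂ : coveredBy f₂ r (h z₁) (h z₄) (breakSet F₂) ⊆ breakSet F₂ := fun b hb => hb.1
  refine ⟨coveredBy f₁ r z₁ z₄ (breakSet F₁), hsub₁,
    coveredBy f₂ r (h z₁) (h z₄) (breakSet F₂), hsub₂, z₁, z₂, z₃, z₄, r, ?_,
    cyclicallyOrdered_coe h12 lt23 lt34 h41, by tauto, rfl, rfl, fun _ => ?_, fun _ => ?_⟩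
  · rw [hβ, prod_jumpRatio_eq F₁ F₂ S hB₁ hB₂, Ne,
      mul_inv_eq_one₀ (jumpProduct_ne_zero hF₂.isLiftFun hP₂ hsub₂)] at hSprod
    exact hSprod
  · obtain ⟨k, hk⟩ := hz.ret
    have hKl : K₀ * l ≤ K * l := mul_le_mul_of_nonneg_right (by linarith) hl0.le
    refine coversRegularly_of_lift (A := 4 * M) hF₁.isLiftFun hD₁ hF₁.coe_apply h12 lt23 lt34 h41
      hz.tower (fun b hb => hb.2) (fun z hz' => (hz.near z hz').2.trans_lt hεδ) ?_ (by linarith)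
      hK1 ?_ ?_ ?_ ?_ ?_ ?_ ?_ (fun z hz' => (hz.near z hz').1.trans hKl)
      ⟨k, fun z hz' => (hk z hz').1.trans hKl⟩
    · intro t ht j hj hb
      obtain ⟨k', hk'⟩ := coe_eq_coe_iff_exists_int.1 (coe_equivIco ((F₁^[j] t : ℝ) : UnitAddCircle))
      have h1 := hz.close t ht (Sum.inl ⟨_, hb.1⟩) j hj k' hk'.symm
      have : 0 < ζ * l := by positivity
      exact ⟨h1.1, by linarith [h1.2]⟩
    all_goals
      simp only [h23, h34, ← hl]
      linarith
  · obtain ⟨k, hk⟩ := hz.ret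
    obtain ⟨u, hu, htow⟩ := hz.tower
    rw [hcoeH, hcoeH, hcoeH, hcoeH, hcoeH]
    refine coversRegularly_of_lift (A := 4 * M) hF₂'l hD₂' hf₂ (hHm h12) (hHm lt23) (hHm lt34) hH41
      ⟨H u, hHm hu, htow.conj hHl hk₀⟩ (fun b hb => by simpa only [hcoeH] using hb.2)
      ?_ ?_ (by linarith) hK2 ?_ ?_ ?_ ?_ ?_ ?_ ?_ ?_ ⟨k, ?_⟩
    · intro y hy
      obtain ⟨z, rfl⟩ := hHl.surjective y
      have hz' : z ∈ Icc z₁ z₄ := ⟨hHm.le_iff_le.1 hy.1, hHm.le_iff_le.1 hy.2⟩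
      exact (hnearH z (hz.near z hz').1 (hz.near z hz').2).2
    · intro y hy j hj hb
      obtain ⟨t, rfl⟩ := hHl.surjective y
      have ht : t ∈ Icc z₁ z₄ := ⟨hHm.le_iff_le.1 hy.1, hHm.le_iff_le.1 hy.2⟩
      have e1 : h.symm ((F₂'^[j] (H t) : ℝ) : UnitAddCircle) = (F₁^[j] t : ℝ) := by
        rw [hit, hH.coe_apply, h.symm_apply_apply]
      obtain ⟨k', hk'⟩ := coe_eq_coe_iff_exists_int.1 ((coe_equivIco _).trans e1)
      have h1 := hz.close t ht (Sum.inr ⟨_, hb.1⟩) j hj k' hk'.symm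
      refine ⟨hHm.monotone h1.1, ?_⟩
      have h2 := (abs_le.1 (hdev2 t ht z₂ hI2)).2
      have h3 := mul_le_mul_of_nonneg_left h1.2 hω₀.le
      have h4 := mul_le_mul_of_nonneg_left hL1 hζ0.le
      rw [← hl] at h3
      linarith
    all_goals try linarith
    · intro y hy
      obtain ⟨z, rfl⟩ := hHl.surjective y
      have hz' : z ∈ Icc z₁ z₄ := ⟨hHm.le_iff_le.1 hy.1, hHm.le_iff_le.1 hy.2⟩
      exact (hnearH z (hz.near z hz').1 (hz.near z hz').2).1
    · intro y hy
      obtain ⟨z, rfl⟩ := hHl.surjective y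
      have hz' : z ∈ Icc z₁ z₄ := ⟨hHm.le_iff_le.1 hy.1, hHm.le_iff_le.1 hy.2⟩
      -- The returned point `F₁^r z - k` is itself close to `x₀` on the scale `l`, so the derivative
      -- of `H` at `x₀` controls its image as well.
      have e1 : F₂'^[r] (H z) - k = H (F₁^[r] z - k) := by
        have := hHl.map_add_int (F₁^[r] z) (-k)
        push_cast at this
        rw [hit, sub_eq_add_neg (F₁^[r] z), this]; ring
      rw [e1]
      exact (hnearH _ (hk z hz').1 (hk z hz').2).1
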